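/- Let $\mathbb{K}$ be an algebraically closed field of characteristic zero, let $q_1,\dots,q_r\in\mathbb{Z}^k$, and grade $\mathbb{K}[T_1,\dots,T_r]$ by $\deg T_i=q_i$. Let $\mathfrak{a}\subseteq\mathbb{K}[T_1,\dots,T_r]$ be a homogeneous ideal containing no monomial, such that the affine variety $X=V(\mathfrak{a})\subseteq\mathbb{K}^r$ is irreducible (that is, $\sqrt{\mathfrak a}$ is prime). Let $\gamma=\mathbb{Q}_{\ge 0}^r$, let $Q:\mathbb{Q}^r\to\mathbb{Q}^k$ be the linear map with $Q(e_i)=q_i$, and assume $\dim Q(\gamma)=k$. A face $\gamma_0\preceq\gamma$ is an $\mathfrak{a}$-face if some $x\in X$ satisfies: $x_i\neq 0$ exactly when $e_i\in\gamma_0$. Write $\Omega^{(j)}$ for the set of $j$-dimensional cones $Q(\gamma_0)$ with $\gamma_0\preceq\gamma$ a face, $\Omega_{\mathfrak a}$ for the set of cones $Q(\gamma_0)$ with $\gamma_0$ an $\mathfrak a$-face (the orbit cones), and $\Omega_{\mathfrak a}^{(j)}\subseteq\Omega_{\mathfrak a}$ for the subset of $j$-dimensional ones. Let $\Omega_0^{(k)}$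 be the set of all $\vartheta\in\Omega^{(k)}$ all of whose facets lie in $\Omega_{\mathfrak a}^{(k-1)}$. For $w\in Q(\gamma)$ the GIT-chamber is $$\lambda(w)=\bigcap_{w\in\vartheta\in\Omega_{\mathfrak a}}\vartheta .$$ Let $w$ lie in the relative interior of $Q(\gamma)$. Then the set $\Omega^{(k)}(w)=\{\vartheta\in\Omega^{(k)};\ w\in\vartheta\}$ is finite, and the following algorithm returns $\lambda(w)$: start with $\lambda:=\mathbb{Q}^k$; for each $\vartheta\in\Omega^{(k)}(w)$, in any order, if $\vartheta\not\supseteq\lambda$ and all facets of $\vartheta$ lie in $\Omega_{\mathfrak a}^{(k-1)}$, replace $\lambda$ by $\lambda\cap\vartheta$. Moreover $$\bigcap_{w\in\vartheta\in\Omega_0^{(k)}}\vartheta\;=\;\bigcap_{w\in\vartheta\in\Omega_{\mathfrak a}^{(k)}}\vartheta\;=\;\lambda(w).$$ -/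

import Mathlib

noncomputable section

namespace GITFan

open MvPolynomial

/-- The positive orthant `γ = ℚ_{≥0}^r`. -/
def orthant (r : ℕ) : PointedCone ℚ (Fin r → ℚ) :=
  PointedCone.positive ℚ (Fin r → ℚ)

open Classical in
/-- The reduction `z_{γ₀}` of an `r`-tuple `z` along `γ₀`: the entries `z i` with `e_i ∉ γ₀`
are replaced by zero. -/
def reduction {K : Type*} [Field K] {r : ℕ} (γ₀ : PointedCone ℚ (Fin r → ℚ)) (z : Fin r → K) :
    Fin r → K :=
  fun i => if (Pi.single i 1 : Fin r → ℚ) ∈ γ₀ then z i else 0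

/-- The torus orbit `𝕋^r_{γ₀} = {t_{γ₀} ; t ∈ (K^*)^r}`. -/
def torusOrbit (K : Type*) [Field K] {r : ℕ} (γ₀ : PointedCone ℚ (Fin r → ℚ)) :
    Set (Fin r → K) :=
  {x | ∃ t : Fin r → Kˣ, x = reduction γ₀ (fun i => (t i : K))}

/-- `γ₀` is an `𝔞`-face: a face of the orthant whose torus orbit meets the zero set of `𝔞`. -/
def IsAFace {K : Type*} [Field K] {r : ℕ} (𝔞 : Ideal (MvPolynomial (Fin r) K))
    (γ₀ : PointedCone ℚ (Fin r → ℚ)) : Prop :=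
  γ₀.IsFaceOf (orthant r) ∧ (torusOrbit K γ₀ ∩ zeroLocus K 𝔞).Nonempty

/-- `𝔞` contains no monomial. -/
def MonomialFree {K : Type*} [Field K] {r : ℕ} (𝔞 : Ideal (MvPolynomial (Fin r) K)) : Prop :=
  ∀ ν : Fin r →₀ ℕ, monomial ν (1 : K) ∉ 𝔞

attribute [local instance] MvPolynomial.weightedGradedAlgebra

/-- `𝔞` is homogeneous for the `ℤ^k`-grading of `K[T_1, …, T_r]` with `deg(T_i) = q_i`. -/
def IsGradedIdeal {K : Type*} [Field K] {r k : ℕ} (q : Fin r → Fin k → ℤ)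
    (𝔞 : Ideal (MvPolynomial (Fin r) K)) : Prop :=
  𝔞.IsHomogeneous (weightedHomogeneousSubmodule K q)

/-- The linear map `Q : ℚ^r → ℚ^k` given by the `k × r` matrix with columns `q_1, …, q_r`. -/
def Q {r k : ℕ} (q : Fin r → Fin k → ℤ) : (Fin r → ℚ) →ₗ[ℚ] (Fin k → ℚ) :=
  Matrix.mulVecLin (Matrix.of fun j i => (q i j : ℚ))

/-- The projected cone `Q(γ₀) ⊆ ℚ^k`. -/
def proj {r k : ℕ} (q : Fin r → Fin k → ℤ) (γ₀ : PointedCone ℚ (Fin r → ℚ)) :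
    PointedCone ℚ (Fin k → ℚ) :=
  PointedCone.map (Q q) γ₀

/-- The dimension of a cone: the dimension of its linear span. -/
def dim {k : ℕ} (ϑ : PointedCone ℚ (Fin k → ℚ)) : ℕ :=
  Module.finrank ℚ (Submodule.span ℚ (ϑ : Set (Fin k → ℚ)))

/-- `η` is a facet of `ϑ`: a face of codimension one. -/
def IsFacet {k : ℕ} (η ϑ : PointedCone ℚ (Fin k → ℚ)) : Prop :=
  η.IsFaceOf ϑ ∧ dim η + 1 = dim ϑ

/-- `Ω^{(j)}`: the `j`-dimensional projected faces of the orthant. -/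
def projFaces {r k : ℕ} (q : Fin r → Fin k → ℤ) (j : ℕ) : Set (PointedCone ℚ (Fin k → ℚ)) :=
  {ϑ | (∃ γ₀, γ₀.IsFaceOf (orthant r) ∧ proj q γ₀ = ϑ) ∧ dim ϑ = j}

/-- `Ω_𝔞`: the projected `𝔞`-faces (orbit cones). -/
def projAFaces {K : Type*} [Field K] {r k : ℕ} (q : Fin r → Fin k → ℤ)
    (𝔞 : Ideal (MvPolynomial (Fin r) K)) : Set (PointedCone ℚ (Fin k → ℚ)) :=
  {ϑ | ∃ γ₀, IsAFace 𝔞 γ₀ ∧ proj q γ₀ = ϑ}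

/-- `Ω_𝔞^{(j)}`: the `j`-dimensional projected `𝔞`-faces. -/
def projAFacesDim {K : Type*} [Field K] {r k : ℕ} (q : Fin r → Fin k → ℤ)
    (𝔞 : Ideal (MvPolynomial (Fin r) K)) (j : ℕ) : Set (PointedCone ℚ (Fin k → ℚ)) :=
  {ϑ | ϑ ∈ projAFaces q 𝔞 ∧ dim ϑ = j}

/-- `Ω_0^{(k)}`: the full-dimensional projected faces all of whose facets belong to
`Ω_𝔞^{(k-1)}`. For `k = 0` there are no facets and the condition is void. -/
def projFacesZero {K : Type*} [Field K] {r k : ℕ} (q : Fin r → Fin k → ℤ)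
    (𝔞 : Ideal (MvPolynomial (Fin r) K)) : Set (PointedCone ℚ (Fin k → ℚ)) :=
  {ϑ | ϑ ∈ projFaces q k ∧ ∀ η, IsFacet η ϑ → η ∈ projAFacesDim q 𝔞 (k - 1)}

/-- The intersection of all cones of the collection `S` that contain `w`. -/
def interAt {k : ℕ} (S : Set (PointedCone ℚ (Fin k → ℚ))) (w : Fin k → ℚ) :
    PointedCone ℚ (Fin k → ℚ) :=
  sInf {ϑ | ϑ ∈ S ∧ w ∈ ϑ}

/-- The GIT-chamber `λ(w)`: the intersection of all projected `𝔞`-faces containing `w`. -/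
def chamber {K : Type*} [Field K] {r k : ℕ} (q : Fin r → Fin k → ℤ)
    (𝔞 : Ideal (MvPolynomial (Fin r) K)) (w : Fin k → ℚ) : PointedCone ℚ (Fin k → ℚ) :=
  interAt (projAFaces q 𝔞) w

open Classical in
/-- The algorithm: start with `ℚ^k`, run through the list `L` of cones, and replace the current
cone `l` by `l ∩ ϑ` whenever `ϑ` does not contain `l` and all facets of `ϑ` lie in `A`. -/
def chamberAlgorithm {k : ℕ} (A : Set (PointedCone ℚ (Fin k → ℚ)))
    (L : List (PointedCone ℚ (Fin k → ℚ))) : PointedCone ℚ (Fin k → ℚ) :=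
  L.foldl (fun l ϑ => if ¬ l ≤ ϑ ∧ (∀ η, IsFacet η ϑ → η ∈ A) then l ⊓ ϑ else l) ⊤

end GITFan

end

noncomputable section

namespace GITFan

/-! Two facts about orbit cones carry the proof; beyond them only finiteness and convexity are used.
(a) Faces of orbit cones are orbit cones (`face_mem_projAFaces`). (b) For an orbit cone `ω` and `v ∈
Q(γ)`, some orbit cone has `ω` as a face and contains `v + z` with `z ∈ ω`
(`exists_orbitCone_isFaceOf`). If `x ∈ X` has orbit cone `ω`, coarsen the grading modulo the degree
of the product of the nonvanishing coordinates of `x`. A point `y ∈ X` with the same invariants as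
`x` that is semistable for the direction `v` has the required cone. It exists by a Nakayama argument
(`exists_point_monomial_ne_zero`), a form of surjectivity of semistable points onto the quotient.

Full-dimensional orbit cones suffice for `λ(w)` (`mem_of_forall_full_dim`): by (b), the orbit cones
having the minimal face `ω ∋ w` of a given orbit cone as a face, enlarged by `-w`, cover the space,
so the full-dimensional ones already do. One of them contains `u` and some `p` with `u + p` a
multiple of `w`, so `u ∈ ω`.

Full-dimensional orbit cones lie in `Ω_0` by (a). Conversely, if `u ∈ λ(w)` lay outside some `ϑ ∈
Ω_0` through `w`, the segment from `u` to `w` would enter `ϑ` through a facet, which is an orbit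
cone. By `mem_of_segment_mem` this facet contains `w`, hence `u`, a contradiction.

The algorithm omits only cones that fail the facet test or already contain the current `λ`. -/

open MvPolynomial Filter Topology

/-! ### Finite generation of monoids of exponents -/

section Gordan

variable {σ G : Type*} [Finite σ] [AddCommGroup G]

/-- In the monoid of pairs `(n, ν)` with `deg ν = n • d`, each element of sufficiently large level
`n` dominates the `N`-th multiple of one of finitely many elements of positive level. -/
theorem exists_finset_multiple_le (w : σ → G) (d : G) :
    ∃ H : Finset (ℕ × (σ →₀ ℕ)),
      (∀ h ∈ H, 0 < h.1 ∧ Finsupp.weight w h.2 = h.1 • d) ∧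
      ∀ N : ℕ, ∃ n, 0 < n ∧ ∀ ν : σ →₀ ℕ, Finsupp.weight w ν = n • d →
        ∃ h ∈ H, N • h.2 ≤ ν := by
  classical
  let f : ℕ × (σ →₀ ℕ) →+ G := (Finsupp.weight w).comp (AddMonoidHom.snd _ _)
  let g : ℕ × (σ →₀ ℕ) →+ G := (multiplesHom G d).comp (AddMonoidHom.fst _ _)
  obtain ⟨S, hS⟩ := AddSubmonoid.fg_eqLocusM f g
  have hmem : ∀ p : ℕ × (σ →₀ ℕ), p ∈ f.eqLocusM g ↔ Finsupp.weight w p.2 = p.1 • d := by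
    intro p; rfl
  refine ⟨S.filter (fun h => 0 < h.1), ?_, ?_⟩
  · intro h hh
    rw [Finset.mem_filter] at hh
    exact ⟨hh.2, (hmem h).1 (hS ▸ AddSubmonoid.subset_closure hh.1)⟩
  · intro N
    -- Generators of level zero add nothing to the level. If all other coefficients were at most
    -- `N`, the level would be at most `N * ∑ h.1`.
    refine ⟨N * (∑ h ∈ S, h.1) + 1, Nat.succ_pos _, fun ν hν => ?_⟩
    have hp : ((N * (∑ h ∈ S, h.1) + 1, ν) : ℕ × (σ →₀ ℕ)) ∈ AddSubmonoid.closure (S : Set _) := by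
      rw [hS, hmem]; exact hν
    rw [AddSubmonoid.mem_closure_finset] at hp
    obtain ⟨e, -, he⟩ := hp
    by_contra! hcon
    have h1 : ∑ h ∈ S, e h * h.1 = N * (∑ h ∈ S, h.1) + 1 := by
      have := congrArg Prod.fst he
      simpa [Prod.fst_sum] using this
    have h2 : ∑ h ∈ S, e h • h.2 = ν := by
      have := congrArg Prod.snd he
      simpa [Prod.snd_sum] using this
    have h3 : ∑ h ∈ S, e h * h.1 ≤ ∑ h ∈ S, N * h.1 := by
      refine Finset.sum_le_sum fun h hh => ?_
      rcases Nat.eq_zero_or_pos h.1 with h0 | h0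
      · simp [h0]
      · refine Nat.mul_le_mul_right _ ?_
        by_contra! hlt
        refine hcon h (Finset.mem_filter.2 ⟨hh, h0⟩) ?_
        calc N • h.2 ≤ e h • h.2 := by gcongr
          _ ≤ ∑ h ∈ S, e h • h.2 :=
            Finset.single_le_sum (f := fun h => e h • h.2) (fun _ _ => zero_le) hh
          _ = ν := h2
    rw [← Finset.mul_sum] at h3
    omega

/-- The exponents of a given degree are finitely generated over those of degree zero. -/
theorem exists_finset_le_of_weight_eq (w : σ → G) (d : G) :
    ∃ B : Finset (σ →₀ ℕ), (∀ b ∈ B, Finsupp.weight w b = d) ∧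
      ∀ ν : σ →₀ ℕ, Finsupp.weight w ν = d → ∃ b ∈ B, b ≤ ν := by
  -- Dickson's lemma: minimal exponents form an antichain in a well-quasi-order.
  have hfin : {ν : σ →₀ ℕ | Minimal (fun ν => Finsupp.weight w ν = d) ν}.Finite :=
    WellQuasiOrderedLE.finite_of_isAntichain (setOfPred_minimal_antichain _)
  refine ⟨hfin.toFinset, fun b hb => ?_, fun ν hν => ?_⟩
  · have hb' : Minimal (fun ν => Finsupp.weight w ν = d) b := (Set.Finite.mem_toFinset hfin).1 hb
    exact hb'.prop
  · obtain ⟨b, hb, hmin⟩ := exists_minimal_le_of_wellFoundedLT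
      (fun ν : σ →₀ ℕ => Finsupp.weight w ν = d) ν hν
    exact ⟨b, (Set.Finite.mem_toFinset hfin).2 hmin, hb⟩

end Gordan

/-! ### Semistable points over a given point of the quotient -/

section Surjectivity

variable {K σ G : Type*} [Field K] [AddCommGroup G]

theorem weightedHomogeneousComponent_mul_of_zero (w : σ → G) (g : G) {c p : MvPolynomial σ K}
    (hc : IsWeightedHomogeneous w c 0) :
    weightedHomogeneousComponent w g (c * p) = c * weightedHomogeneousComponent w g p := by
  classical
  induction p using MvPolynomial.induction_on' with
  | monomial u a =>
    have hm : IsWeightedHomogeneous w (monomial u a : MvPolynomial σ K) (Finsupp.weight w u) :=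
      isWeightedHomogeneous_monomial _ _ _ rfl
    have hcm := hc.mul hm
    rw [zero_add] at hcm
    by_cases h : Finsupp.weight w u = g
    · subst h
      rw [hm.weightedHomogeneousComponent_same, hcm.weightedHomogeneousComponent_same]
    · rw [hm.weightedHomogeneousComponent_ne _ (Ne.symm h),
        hcm.weightedHomogeneousComponent_ne _ (Ne.symm h), mul_zero]
  | add p q hp hq => rw [mul_add, map_add, hp, hq, map_add, mul_add]

/-- The polynomials of degree zero. -/
def degreeZero (K : Type*) [Field K] (w : σ → G) : Subalgebra K (MvPolynomial σ K) where
  carrier := {p | IsWeightedHomogeneous w p 0}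
  mul_mem' ha hb := by simpa using IsWeightedHomogeneous.mul ha hb
  add_mem' ha hb := IsWeightedHomogeneous.add ha hb
  algebraMap_mem' r := isWeightedHomogeneous_C w r

/-- The maximal ideal of a point in the ring of polynomials of degree zero. -/
def pointIdeal (w : σ → G) (x : σ → K) : Ideal (degreeZero K w) :=
  RingHom.ker ((aeval x : MvPolynomial σ K →ₐ[K] K).comp (degreeZero K w).val)

theorem mem_pointIdeal {w : σ → G} {x : σ → K} {c : degreeZero K w} :
    c ∈ pointIdeal w x ↔ aeval x (c : MvPolynomial σ K) = 0 := Iff.rfl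

/-- The image of the polynomials of degree `g` in the coordinate ring, as a module over the
polynomials of degree zero. -/
def gradedPiece (I : Ideal (MvPolynomial σ K)) (w : σ → G) (g : G) :
    Submodule (degreeZero K w) (MvPolynomial σ K ⧸ I) where
  carrier := {z | ∃ p, IsWeightedHomogeneous w p g ∧ Ideal.Quotient.mk I p = z}
  add_mem' := by
    rintro _ _ ⟨p, hp, rfl⟩ ⟨p', hp', rfl⟩
    exact ⟨p + p', hp.add hp', map_add _ _ _⟩
  zero_mem' := ⟨0, isWeightedHomogeneous_zero _ _ _, map_zero _⟩
  smul_mem' := by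
    rintro ⟨c, hc⟩ _ ⟨p, hp, rfl⟩
    refine ⟨c * p, by simpa using IsWeightedHomogeneous.mul hc hp, ?_⟩
    rw [map_mul]; rfl

/-- The finiteness needed for Nakayama: a monomial of degree `g` is a minimal one times a monomial
of degree zero. -/
theorem gradedPiece_fg [Finite σ] (I : Ideal (MvPolynomial σ K)) (w : σ → G) (g : G) :
    (gradedPiece I w g).FG := by
  classical
  obtain ⟨B, hB, hB'⟩ := exists_finset_le_of_weight_eq w g
  refine ⟨B.image (fun b => Ideal.Quotient.mk I (monomial b 1)), le_antisymm ?_ ?_⟩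
  · rw [Submodule.span_le]
    intro z hz
    obtain ⟨b, hb, rfl⟩ := Finset.mem_image.1 (Finset.mem_coe.1 hz)
    exact ⟨_, isWeightedHomogeneous_monomial _ _ _ (hB b hb), rfl⟩
  · rintro _ ⟨p, hp, rfl⟩
    rw [p.as_sum, map_sum]
    refine Submodule.sum_mem _ fun ν hν => ?_
    obtain ⟨b, hb, hle⟩ := hB' ν (hp (mem_support_iff.1 hν))
    have hν' : Finsupp.weight w ν = g := hp (mem_support_iff.1 hν)
    have hc : IsWeightedHomogeneous w (monomial (ν - b) (coeff ν p)) 0 := by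
      refine isWeightedHomogeneous_monomial _ _ _ ?_
      have : Finsupp.weight w (b + (ν - b)) = Finsupp.weight w b := by
        rw [add_tsub_cancel_of_le hle, hν', hB b hb]
      rwa [map_add, add_eq_left] at this
    have : Ideal.Quotient.mk I (monomial ν (coeff ν p)) =
        (⟨_, hc⟩ : degreeZero K w) • Ideal.Quotient.mk I (monomial b 1) := by
      change _ = Ideal.Quotient.mk I _ * Ideal.Quotient.mk I _
      rw [← map_mul, monomial_mul, mul_one, tsub_add_cancel_of_le hle]
    rw [this]
    exact Submodule.smul_mem _ _ (Submodule.subset_span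
      (Finset.mem_coe.2 (Finset.mem_image_of_mem _ hb)))

/-- A homogeneous element of `I + 𝔪` lies in `𝔪 • S_g` modulo `J ≥ I`. -/
theorem mk_mem_pointIdeal_smul {I J : Ideal (MvPolynomial σ K)} (hIJ : I ≤ J) (w : σ → G)
    (hI : ∀ p ∈ I, ∀ g, weightedHomogeneousComponent w g p ∈ I) (x : σ → K) {g : G}
    {p : MvPolynomial σ K} (hp : IsWeightedHomogeneous w p g)
    (hmem : p ∈ I ⊔ Ideal.span {c | IsWeightedHomogeneous w c 0 ∧ aeval x c = 0}) :
    Ideal.Quotient.mk J p ∈ pointIdeal w x • gradedPiece J w g := by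
  obtain ⟨a, ha, m, hm, rfl⟩ := Submodule.mem_sup.1 hmem
  -- The free cofactor `s` absorbs the arbitrary multipliers met in the span induction.
  have key : ∀ m ∈ Ideal.span {c | IsWeightedHomogeneous w c 0 ∧ aeval x c = 0},
      ∀ s, Ideal.Quotient.mk J (weightedHomogeneousComponent w g (m * s)) ∈
        pointIdeal w x • gradedPiece J w g := by
    intro m hm
    induction hm using Submodule.span_induction with
    | mem c hc =>
      intro s
      rw [weightedHomogeneousComponent_mul_of_zero w g hc.1]
      have hc' : (⟨c, hc.1⟩ : degreeZero K w) ∈ pointIdeal w x := mem_pointIdeal.2 hc.2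
      have hs : Ideal.Quotient.mk J (weightedHomogeneousComponent w g s) ∈ gradedPiece J w g :=
        ⟨_, weightedHomogeneousComponent_mem w s g, rfl⟩
      have := Submodule.smul_mem_smul hc' hs
      rw [map_mul]
      exact this
    | zero => simp
    | add m m' _ _ h h' =>
      intro s
      rw [add_mul, map_add, map_add]
      exact add_mem (h s) (h' s)
    | smul t m _ h =>
      intro s
      rw [smul_eq_mul, mul_comm t, mul_assoc]
      exact h (t * s)
  have h1 := hp.weightedHomogeneousComponent_same
  rw [← h1, map_add, map_add, Ideal.Quotient.eq_zero_iff_mem.2 (hIJ (hI a ha g)), zero_add,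
    ← mul_one m]
  exact key m hm 1

/-- Let `x` be a point of the irreducible variety `X` of a homogeneous ideal `I`. If a monomial
`T^β` does not vanish on `X`, then some `y ∈ X` has the same invariants as `x` and a nonvanishing
monomial of degree a positive multiple of `deg T^β`. -/
theorem exists_point_monomial_ne_zero [IsAlgClosed K] [Finite σ] {I : Ideal (MvPolynomial σ K)}
    (w : σ → G) (hI : ∀ p ∈ I, ∀ g, weightedHomogeneousComponent w g p ∈ I)
    (hprime : I.radical.IsPrime) {x : σ → K} (hx : x ∈ zeroLocus K I) {β : σ →₀ ℕ}
    (hβ : monomial β (1 : K) ∉ I.radical) :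
    ∃ y ∈ zeroLocus K I,
      (∀ p : MvPolynomial σ K, IsWeightedHomogeneous w p 0 → aeval y p = aeval x p) ∧
      ∃ n, 0 < n ∧ ∃ ν : σ →₀ ℕ, Finsupp.weight w ν = n • Finsupp.weight w β ∧
        aeval y (monomial ν (1 : K)) ≠ 0 := by
  classical
  by_contra! hcon
  -- The zeros of `E` are the points of `X` with the same invariants as `x`. If no `y` exists, the
  -- monomials from `H` vanish there, so by the Nullstellensatz they are nilpotent modulo `E`.
  set E : Ideal (MvPolynomial σ K) :=
    I ⊔ Ideal.span {c | IsWeightedHomogeneous w c 0 ∧ aeval x c = 0} with hE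
  obtain ⟨H, hH, hH'⟩ := exists_finset_multiple_le w (Finsupp.weight w β)
  have hnil : ∀ h ∈ H, monomial h.2 (1 : K) ∈ E.radical := by
    intro h hh
    rw [← vanishingIdeal_zeroLocus_eq_radical (K := K), mem_vanishingIdeal_iff]
    intro y hy
    refine hcon y (zeroLocus_anti_mono le_sup_left hy) (fun p hp => ?_) h.1 (hH h hh).1 h.2
      (hH h hh).2
    have hc : p - C (aeval x p) ∈ E := by
      refine (le_sup_right : _ ≤ E) (Ideal.subset_span ⟨?_, ?_⟩)
      · exact hp.sub (isWeightedHomogeneous_C _ _)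
      · simp
    have := hy _ hc
    simpa [sub_eq_zero] using this
  choose! N hN using hnil
  obtain ⟨n, hn, hn'⟩ := hH' (∑ h ∈ H, N h)
  have hall : ∀ ν : σ →₀ ℕ, Finsupp.weight w ν = n • Finsupp.weight w β →
      monomial ν (1 : K) ∈ E := by
    intro ν hν
    obtain ⟨h, hh, hle⟩ := hn' ν hν
    have hle' : N h • h.2 ≤ ν := le_trans
      (nsmul_le_nsmul_left (zero_le) (Finset.single_le_sum (fun _ _ => zero_le) hh)) hle
    have : monomial ν (1 : K) = monomial (ν - N h • h.2) 1 * monomial h.2 1 ^ N h := by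
      rw [monomial_pow, one_pow, monomial_mul, mul_one, tsub_add_cancel_of_le hle']
    rw [this]
    exact Ideal.mul_mem_left _ _ (hN h hh)
  have hle : gradedPiece I.radical w (n • Finsupp.weight w β) ≤
      pointIdeal w x • gradedPiece I.radical w (n • Finsupp.weight w β) := by
    rintro _ ⟨p, hp, rfl⟩
    refine mk_mem_pointIdeal_smul Ideal.le_radical w hI x hp ?_
    rw [p.as_sum]
    refine Submodule.sum_mem _ fun ν hν => ?_
    have := hall ν (hp (mem_support_iff.1 hν))
    have h2 : monomial ν (coeff ν p) = C (coeff ν p) * monomial ν (1 : K) := by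
      rw [C_mul_monomial, mul_one]
    rw [h2]
    exact Ideal.mul_mem_left _ _ this
  -- Nakayama: an invariant `s` with `s(x) = 1` annihilates the graded piece, which contains the
  -- class of `T^(nβ)`. Primeness rules this out.
  obtain ⟨s, hs, hs'⟩ := Submodule.exists_sub_one_mem_and_smul_eq_zero_of_fg_of_le_smul _ _
    (gradedPiece_fg _ _ _) hle
  have hsx : aeval x (s : MvPolynomial σ K) = 1 := by
    have := mem_pointIdeal.1 hs
    simpa [sub_eq_zero] using this
  have hmon : (monomial β (1 : K)) ^ n ∉ I.radical := fun h => hβ (hprime.mem_of_pow_mem _ h)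
  have hdeg : IsWeightedHomogeneous w ((monomial β (1 : K)) ^ n) (n • Finsupp.weight w β) :=
    (isWeightedHomogeneous_monomial _ _ _ rfl).pow n
  have h0 : Ideal.Quotient.mk I.radical (s * (monomial β (1 : K)) ^ n) = 0 := by
    rw [map_mul]
    exact hs' _ ⟨_, hdeg, rfl⟩
  rw [Ideal.Quotient.eq_zero_iff_mem] at h0
  rcases hprime.mem_or_mem h0 with h | h
  · have := radical_le_vanishingIdeal_zeroLocus (K := K) I h x hx
    rw [hsx] at this
    exact one_ne_zero this
  · exact hmon h

end Surjectivity

/-! ### Polyhedral cones over the rationals -/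

section Polyhedral

variable {V : Type*} [AddCommGroup V] [Module ℚ V]

/-- `H` describes the cone `C` as a finite intersection of half-spaces. -/
def Describes (H : Finset (Module.Dual ℚ V)) (C : PointedCone ℚ V) : Prop :=
  ∀ z, z ∈ C ↔ ∀ l ∈ H, 0 ≤ l z

theorem exists_describes_bot [FiniteDimensional ℚ V] :
    ∃ H : Finset (Module.Dual ℚ V), Describes H ⊥ := by
  classical
  let b := Module.finBasis ℚ V
  refine ⟨Finset.univ.image b.coord ∪ Finset.univ.image (fun i => -b.coord i), fun z => ?_⟩
  constructor
  · intro hz l _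
    rw [(Submodule.mem_bot _).1 hz, map_zero]
  · intro h
    refine (Submodule.mem_bot _).2 (b.ext_elem fun i => ?_)
    have h1 := h (b.coord i) (by simp)
    have h2 := h (-b.coord i) (by simp)
    simp only [LinearMap.neg_apply, Module.Basis.coord_apply] at h1 h2
    rw [map_zero, Finsupp.zero_apply]
    linarith

/-- Fourier–Motzkin elimination of one ray. -/
theorem exists_describes_insert {H : Finset (Module.Dual ℚ V)} {S : Set V}
    (hH : Describes H (PointedCone.hull ℚ S)) (v : V) :
    ∃ H' : Finset (Module.Dual ℚ V), Describes H' (PointedCone.hull ℚ (insert v S)) := by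
  classical
  let A := H.filter (fun l => 0 ≤ l v)
  let P := H.filter (fun l => 0 < l v)
  let N := H.filter (fun l => l v < 0)
  -- Membership asks for `t ≥ 0` with `z - t • v` in the old cone. Functionals in `N` bound `t`
  -- below, those in `P` above; the combinations vanish at `v` and say that lower bounds do not
  -- exceed upper ones.
  refine ⟨A ∪ (P ×ˢ N).image (fun p => (-p.2 v) • p.1 + p.1 v • p.2), fun z => ?_⟩
  have hmem : z ∈ PointedCone.hull ℚ (insert v S) ↔
      ∃ t : ℚ, 0 ≤ t ∧ ∀ l ∈ H, 0 ≤ l z - t * l v := by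
    rw [PointedCone.hull, Submodule.mem_span_insert]
    constructor
    · rintro ⟨t, y, hy, rfl⟩
      refine ⟨t, t.2, fun l hl => ?_⟩
      have := (hH y).1 hy l hl
      have e : l (t • v) = t * l v := by
        rw [← smul_eq_mul, ← map_smul]; rfl
      rw [map_add, e]
      linarith
    · rintro ⟨t, ht, h⟩
      refine ⟨⟨t, ht⟩, z - t • v, (hH _).2 fun l hl => ?_, ?_⟩
      · simpa using h l hl
      · change z = t • v + (z - t • v)
        abel
  rw [hmem]
  constructor
  · rintro ⟨t, ht, h⟩ l hl
    rcases Finset.mem_union.1 hl with hl | hl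
    · obtain ⟨hl, hlv⟩ := Finset.mem_filter.1 hl
      nlinarith [h l hl, mul_nonneg ht hlv]
    · obtain ⟨⟨a, b⟩, hab, rfl⟩ := Finset.mem_image.1 hl
      obtain ⟨ha, hb⟩ := Finset.mem_product.1 hab
      obtain ⟨ha, hav⟩ := Finset.mem_filter.1 ha
      obtain ⟨hb, hbv⟩ := Finset.mem_filter.1 hb
      simp only [LinearMap.add_apply, LinearMap.smul_apply, smul_eq_mul] at *
      nlinarith [mul_nonneg (neg_pos.2 hbv).le (h a ha), mul_nonneg hav.le (h b hb)]
  · intro h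
    have hA : ∀ l ∈ H, 0 ≤ l v → 0 ≤ l z := fun l hl hlv =>
      h l (Finset.mem_union_left _ (Finset.mem_filter.2 ⟨hl, hlv⟩))
    have hPN : ∀ a ∈ H, 0 < a v → ∀ b ∈ H, b v < 0 → 0 ≤ -b v * a z + a v * b z := by
      intro a ha hav b hb hbv
      have := h _ (Finset.mem_union_right _ (Finset.mem_image_of_mem
        (fun p : Module.Dual ℚ V × Module.Dual ℚ V => (-p.2 v) • p.1 + p.1 v • p.2)
        (Finset.mk_mem_product (Finset.mem_filter.2 ⟨ha, hav⟩) (Finset.mem_filter.2 ⟨hb, hbv⟩))))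
      simpa using this
    rcases N.eq_empty_or_nonempty with hN | hN
    · refine ⟨0, le_rfl, fun l hl => ?_⟩
      have : 0 ≤ l v := by
        by_contra! hlt
        have : l ∈ N := Finset.mem_filter.2 ⟨hl, hlt⟩
        simp [hN] at this
      simpa using hA l hl this
    · obtain ⟨b, hb, hmax⟩ := N.exists_max_image (fun l => l z / l v) hN
      obtain ⟨hb, hbv⟩ := Finset.mem_filter.1 hb
      refine ⟨max 0 (b z / b v), le_max_left _ _, fun l hl => ?_⟩
      rcases lt_trichotomy (l v) 0 with hlv | hlv | hlv
      · have h1 := (hmax l (Finset.mem_filter.2 ⟨hl, hlv⟩)).trans (le_max_right 0 _)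
        rw [div_le_iff_of_neg hlv] at h1
        linarith
      · rw [hlv, mul_zero, sub_zero]
        exact hA l hl hlv.ge
      · rw [sub_nonneg, ← le_div_iff₀ hlv]
        refine max_le (div_nonneg (hA l hl hlv.le) hlv.le) ?_
        rw [div_le_iff_of_neg hbv, div_mul_eq_mul_div, div_le_iff₀ hlv]
        nlinarith [hPN l hl hlv b hb hbv]

theorem exists_describes_hull [FiniteDimensional ℚ V] (S : Finset V) :
    ∃ H : Finset (Module.Dual ℚ V), Describes H (PointedCone.hull ℚ (S : Set V)) := by
  classical
  induction S using Finset.induction_on with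
  | empty =>
    obtain ⟨H, hH⟩ := exists_describes_bot (V := V)
    refine ⟨H, ?_⟩
    rwa [Finset.coe_empty, PointedCone.hull, Submodule.span_empty]
  | insert v S _ ih =>
    obtain ⟨H, hH⟩ := ih
    rw [Finset.coe_insert]
    exact exists_describes_insert hH v

/-- A finitely generated cone is a finite intersection of half-spaces. -/
theorem exists_describes_of_fg [FiniteDimensional ℚ V] {C : PointedCone ℚ V} (hC : C.FG) :
    ∃ H : Finset (Module.Dual ℚ V), Describes H C := by
  obtain ⟨S, rfl⟩ := hC
  exact exists_describes_hull S

/-- The first point of a polyhedral cone on a segment entering it from outside. -/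
theorem Describes.exists_first_hit {H : Finset (Module.Dual ℚ V)} {C : PointedCone ℚ V}
    (hH : Describes H C) {a b : V} (ha : a ∉ C) (hb : b ∈ C) :
    ∃ l ∈ H, ∃ t : ℚ, 0 < t ∧ t ≤ 1 ∧ l a < 0 ∧ l ((1 - t) • a + t • b) = 0 ∧
      (1 - t) • a + t • b ∈ C ∧ ∀ s : ℚ, (1 - s) • a + s • b ∈ C → t ≤ s := by
  classical
  have hb' := (hH b).1 hb
  have hne : (H.filter (fun l => l a < 0)).Nonempty := by
    rw [hH] at ha
    push Not at ha
    obtain ⟨l, hl, hla⟩ := ha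
    exact ⟨l, Finset.mem_filter.2 ⟨hl, hla⟩⟩
  -- The quotient is the parameter at which `l` vanishes; the last violated inequality to become
  -- valid decides the entry into `C`.
  obtain ⟨l, hl, hmax⟩ := Finset.exists_max_image _ (fun l => -l a / (l b - l a)) hne
  obtain ⟨hl, hla⟩ := Finset.mem_filter.1 hl
  have hpos : 0 < l b - l a := by linarith [hb' l hl]
  set t := -l a / (l b - l a) with ht
  have htl : t * (l b - l a) = -l a := by rw [ht]; field_simp
  have ht0 : 0 < t := div_pos (by linarith) hpos
  have ht1 : t ≤ 1 := by rw [ht, div_le_one hpos]; linarith [hb' l hl]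
  refine ⟨l, hl, t, ht0, ht1, hla, ?_, ?_, ?_⟩
  · simp only [map_add, map_smul, smul_eq_mul]; linarith
  · refine (hH _).2 fun m hm => ?_
    simp only [map_add, map_smul, smul_eq_mul]
    rcases lt_or_ge (m a) 0 with hma | hma
    · have hmpos : 0 < m b - m a := by linarith [hb' m hm]
      have := hmax m (Finset.mem_filter.2 ⟨hm, hma⟩)
      rw [div_le_iff₀ hmpos] at this
      linarith
    · exact add_nonneg (mul_nonneg (by linarith) hma) (mul_nonneg ht0.le (hb' m hm))
  · intro s hs
    have := (hH _).1 hs l hl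
    simp only [map_add, map_smul, smul_eq_mul] at this
    by_contra! hlt
    nlinarith [mul_pos (sub_pos.2 hlt) hpos]

theorem exists_pos_forall_add_nonneg {ι : Type*} (s : Finset ι) (f g : ι → ℚ)
    (hf : ∀ i ∈ s, 0 < f i) : ∃ ε : ℚ, 0 < ε ∧ ∀ i ∈ s, 0 ≤ f i + ε * g i := by
  have h1 : ∀ᶠ ε : ℚ in 𝓝[>] 0, ∀ i ∈ s, 0 ≤ f i + ε * g i := by
    rw [eventually_all_finset]
    intro i hi
    have hc : ContinuousAt (fun ε : ℚ => f i + ε * g i) 0 := by fun_prop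
    have : ∀ᶠ ε : ℚ in 𝓝 0, 0 < f i + ε * g i := hc.eventually (lt_mem_nhds (by simpa using hf i hi))
    exact (this.filter_mono nhdsWithin_le_nhds).mono fun _ h => h.le
  obtain ⟨ε, h, hε⟩ := (h1.and self_mem_nhdsWithin).exists
  exact ⟨ε, hε, h⟩

/-- In a full-dimensional cone with an irredundant description, each inequality that is violated
somewhere cuts out a subset spanning a hyperplane. -/
theorem Describes.span_inf_ker {H : Finset (Module.Dual ℚ V)} {C : PointedCone ℚ V}
    (hH : Minimal (fun H => Describes H C) H) (hC : Submodule.span ℚ (C : Set V) = ⊤)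
    {l : Module.Dual ℚ V} (hl : l ∈ H) :
    Submodule.span ℚ {z | z ∈ C ∧ l z = 0} = LinearMap.ker l := by
  classical
  have hHC := hH.prop
  refine le_antisymm (Submodule.span_le.2 fun z hz => hz.2) fun v hv => ?_
  -- By minimality of `H`, some point violates `l` alone.
  obtain ⟨z, hzl, hz⟩ : ∃ z, l z < 0 ∧ ∀ i ∈ H.erase l, 0 ≤ i z := by
    by_contra! hcon
    have : Describes (H.erase l) C := fun z => by
      refine ⟨fun hz i hi => (hHC z).1 hz i (Finset.mem_of_mem_erase hi), fun h => ?_⟩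
      refine (hHC z).2 fun i hi => ?_
      rcases eq_or_ne i l with rfl | hne
      · by_contra! hlt
        obtain ⟨j, hj, hj'⟩ := hcon z hlt
        exact hj'.not_ge (h j hj)
      · exact h i (Finset.mem_erase.2 ⟨hne, hi⟩)
    exact Finset.notMem_erase l H (hH.le_of_le this (Finset.erase_subset _ _) hl)
  have hpos : ∀ i ∈ H, i ≠ 0 → ∃ a ∈ C, 0 < i a := by
    intro i hi hne
    by_contra! hcon
    refine hne (LinearMap.ext_on hC fun a ha => ?_)
    exact le_antisymm (hcon a ha) ((hHC a).1 ha i hi)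
  choose! a ha ha' using hpos
  set z₀ := ∑ i ∈ H.filter (fun i => i ≠ 0), a i with hz₀
  have hz₀C : z₀ ∈ C := Submodule.sum_mem _ fun i hi =>
    ha i (Finset.mem_filter.1 hi).1 (Finset.mem_filter.1 hi).2
  have hz₀pos : ∀ i ∈ H, i ≠ 0 → 0 < i z₀ := by
    intro i hi hne
    rw [hz₀, map_sum]
    refine Finset.sum_pos' (fun j hj => ?_) ⟨i, Finset.mem_filter.2 ⟨hi, hne⟩, ha' i hi hne⟩
    exact (hHC _).1 (ha j (Finset.mem_filter.1 hj).1 (Finset.mem_filter.1 hj).2) i hi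
  have hl0 : l ≠ 0 := by rintro rfl; simp at hzl
  -- Up to scaling, this is where the segment from `z` to the interior point `z₀` crosses `l = 0`.
  -- All other nonzero functionals of `H` are positive there, so small moves inside `ker l` stay in
  -- `C`.
  set z₁ := l z₀ • z + (-l z) • z₀ with hz₁
  have hlz₁ : l z₁ = 0 := by simp [hz₁]; ring
  have hz₁pos : ∀ i ∈ H, i ≠ 0 → i ≠ l → 0 < i z₁ := by
    intro i hi hne hil
    have h1 := hz i (Finset.mem_erase.2 ⟨hil, hi⟩)
    have h2 := hz₀pos i hi hne
    have h3 := hz₀pos l hl hl0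
    simp only [hz₁, map_add, map_smul, smul_eq_mul]
    nlinarith [mul_nonneg h3.le h1, mul_pos (neg_pos.2 hzl) h2]
  obtain ⟨ε, hε, hε'⟩ := exists_pos_forall_add_nonneg (H.filter (fun i => i ≠ 0 ∧ i ≠ l))
    (fun i => i z₁) (fun i => i v) (fun i hi => by
      obtain ⟨h1, h2, h3⟩ := Finset.mem_filter.1 hi
      exact hz₁pos i h1 h2 h3)
  have hlv : l v = 0 := hv
  have hmem : ∀ s : ℚ, (s = 0 ∨ s = ε) → z₁ + s • v ∈ {z | z ∈ C ∧ l z = 0} := by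
    intro s hs
    refine ⟨(hHC _).2 fun i hi => ?_, by simp [hlz₁, hlv]⟩
    by_cases hi0 : i = 0
    · simp [hi0]
    by_cases hil : i = l
    · simp [hil, hlz₁, hlv]
    rcases hs with rfl | rfl
    · simpa using (hz₁pos i hi hi0 hil).le
    · simpa using hε' i (Finset.mem_filter.2 ⟨hi, hi0, hil⟩)
  have : v = ε⁻¹ • ((z₁ + ε • v) - (z₁ + (0 : ℚ) • v)) := by
    rw [zero_smul, add_zero, add_sub_cancel_left, smul_smul, inv_mul_cancel₀ hε.ne', one_smul]
  rw [this]
  exact Submodule.smul_mem _ _ (Submodule.sub_mem _ (Submodule.subset_span (hmem _ (Or.inr rfl)))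
    (Submodule.subset_span (hmem _ (Or.inl rfl))))

/-- The minimal face of `C` containing a point `w ∈ C`. -/
def minFace (C : PointedCone ℚ V) (w : V) : PointedCone ℚ V where
  carrier := {z | z ∈ C ∧ ∃ c : ℚ, 0 ≤ c ∧ c • w - z ∈ C}
  add_mem' := by
    rintro a b ⟨ha, c, hc, hca⟩ ⟨hb, d, hd, hdb⟩
    refine ⟨add_mem ha hb, c + d, add_nonneg hc hd, ?_⟩
    have : (c + d) • w - (a + b) = (c • w - a) + (d • w - b) := by rw [add_smul]; abel
    rw [this]
    exact add_mem hca hdb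
  zero_mem' := ⟨zero_mem _, 0, le_rfl, by simp⟩
  smul_mem' := by
    rintro ⟨s, hs⟩ z ⟨hz, c, hc, hcz⟩
    refine ⟨C.smul_mem hs hz, s * c, mul_nonneg hs hc, ?_⟩
    have : (s * c) • w - (⟨s, hs⟩ : {c : ℚ // 0 ≤ c}) • z = s • (c • w - z) := by
      rw [smul_sub, smul_smul]; rfl
    rw [this]
    exact C.smul_mem hs hcz

theorem mem_minFace {C : PointedCone ℚ V} {w z : V} :
    z ∈ minFace C w ↔ z ∈ C ∧ ∃ c : ℚ, 0 ≤ c ∧ c • w - z ∈ C := Iff.rfl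

theorem minFace_isFaceOf (C : PointedCone ℚ V) (w : V) : (minFace C w).IsFaceOf C where
  le _ hz := hz.1
  mem_of_smul_add_mem := by
    rintro x y a hx hy ha ⟨-, c, hc, hcz⟩
    refine ⟨hx, a⁻¹ * c, by positivity, ?_⟩
    have : (a⁻¹ * c) • w - x = a⁻¹ • ((c • w - (a • x + y)) + y) := by
      rw [sub_add_eq_sub_sub, sub_add_cancel, smul_sub, smul_smul, smul_smul,
        inv_mul_cancel₀ ha.ne', one_smul]
    rw [this]
    exact C.smul_mem (by positivity) (add_mem hcz hy)

theorem self_mem_minFace {C : PointedCone ℚ V} {w : V} (hw : w ∈ C) : w ∈ minFace C w :=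
  ⟨hw, 1, zero_le_one, by simp⟩

/-- If finitely many finitely generated cones cover the space, then so do the full-dimensional
ones. -/
theorem exists_mem_of_forall_exists_mem [FiniteDimensional ℚ V] {ι : Type*} {S : Set ι}
    (hS : S.Finite) (D : ι → PointedCone ℚ V) (hD : ∀ i ∈ S, (D i).FG) (U : ι → Submodule ℚ V)
    (hDU : ∀ i ∈ S, ∀ z ∈ D i, z ∈ U i) (hcov : ∀ v, ∃ i ∈ S, v ∈ D i) (v : V) :
    ∃ i ∈ S, U i = ⊤ ∧ v ∈ D i := by
  classical
  by_contra! hcon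
  -- For a generic direction `p` and small `t > 0`, `v + t • p` avoids every cone: those with `U i =
  -- ⊤` miss `v` and are closed, and the line meets each proper `U i` at most once.
  obtain ⟨p, hp⟩ : ∃ p : V, ∀ i ∈ S, U i ≠ ⊤ → p ∉ U i := by
    have hfin : (U '' {i | i ∈ S ∧ U i ≠ ⊤}).Finite := (hS.subset fun i hi => hi.1).image U
    have h1 := Subspace.biUnion_ne_univ_of_top_notMem (s := hfin.toFinset) (by
      simp only [Set.Finite.mem_toFinset, Set.mem_image]
      rintro ⟨i, hi, h⟩
      exact hi.2 h)
    obtain ⟨p, hp⟩ := (Set.ne_univ_iff_exists_notMem _).1 h1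
    refine ⟨p, fun i hi hne hpi => hp ?_⟩
    simp only [Set.mem_iUnion]
    exact ⟨U i, (Set.Finite.mem_toFinset hfin).2 ⟨i, ⟨hi, hne⟩, rfl⟩, hpi⟩
  have hev : ∀ᶠ t : ℚ in 𝓝[>] 0, ∀ i ∈ S, v + t • p ∉ D i := by
    rw [eventually_all_finite hS]
    intro i hi
    by_cases hU : U i = ⊤
    · obtain ⟨H, hH⟩ := exists_describes_of_fg (hD i hi)
      have hv := hcon i hi hU
      rw [hH] at hv
      push Not at hv
      obtain ⟨l, hl, hlv⟩ := hv
      have hc : ContinuousAt (fun t : ℚ => l v + t * l p) 0 := by fun_prop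
      have : ∀ᶠ t : ℚ in 𝓝 0, l v + t * l p < 0 :=
        hc.eventually (gt_mem_nhds (by simpa using hlv))
      refine (this.filter_mono nhdsWithin_le_nhds).mono fun t ht hmem => ?_
      have := (hH _).1 hmem l hl
      simp only [map_add, map_smul, smul_eq_mul] at this
      linarith
    · have hpU := hp i hi hU
      by_cases hex : ∃ t₀ : ℚ, v + t₀ • p ∈ U i
      · obtain ⟨t₀, ht₀⟩ := hex
        have hne : ∀ᶠ t : ℚ in 𝓝[>] 0, t ≠ t₀ := by
          by_cases h0 : t₀ = 0
          · filter_upwards [self_mem_nhdsWithin] with t ht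
            rw [h0]
            exact ne_of_gt ht
          · exact (eventually_ne_nhds (Ne.symm h0)).filter_mono nhdsWithin_le_nhds
        refine hne.mono fun t ht hmem => hpU ?_
        have h1 := (U i).sub_mem (hDU i hi _ hmem) ht₀
        rw [add_sub_add_left_eq_sub, ← sub_smul] at h1
        exact ((U i).smul_mem_iff (sub_ne_zero.2 ht)).1 h1
      · exact Eventually.of_forall fun t hmem => hex ⟨t, hDU i hi _ hmem⟩
  obtain ⟨t, ht⟩ := hev.exists
  obtain ⟨i, hi, hmem⟩ := hcov (v + t • p)
  exact ht i hi hmem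

end Polyhedral

/-! ### Entering a cone through a facet -/

section Facet

variable {k : ℕ}

/-- A segment leaving a full-dimensional finitely generated cone leaves it through a facet. -/
theorem exists_isFacet_mem {C : PointedCone ℚ (Fin k → ℚ)} (hC : C.FG) (hdim : dim C = k)
    {u w : Fin k → ℚ} (hu : u ∉ C) (hw : w ∈ C) :
    ∃ η, IsFacet η C ∧ ∃ t : ℚ, 0 < t ∧ t ≤ 1 ∧ (1 - t) • u + t • w ∈ η := by
  have htop : Submodule.span ℚ (C : Set (Fin k → ℚ)) = ⊤ :=
    Submodule.eq_top_of_finrank_eq (by rw [Module.finrank_fin_fun]; exact hdim)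
  obtain ⟨H₀, hH₀⟩ := exists_describes_of_fg hC
  obtain ⟨H, -, hH⟩ := exists_minimal_le_of_wellFoundedLT (fun H => Describes H C) H₀ hH₀
  obtain ⟨l, hl, t, ht0, ht1, hlu, hlp, hpC, -⟩ := hH.prop.exists_first_hit hu hw
  have hker := Describes.span_inf_ker hH htop hl
  refine ⟨C ⊓ PointedCone.ofSubmodule (LinearMap.ker l), ⟨⟨inf_le_left, ?_⟩, ?_⟩,
    t, ht0, ht1, hpC, hlp⟩
  · rintro x y a hx hy ha ⟨-, hxy⟩
    refine ⟨hx, ?_⟩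
    have h1 := (hH.prop x).1 hx l hl
    have h2 := (hH.prop y).1 hy l hl
    have h3 : a * l x + l y = 0 := by simpa using hxy
    change l x = 0
    nlinarith [mul_nonneg ha.le h1]
  · have hl0 : l ≠ 0 := by rintro rfl; simp at hlu
    have h1 := Module.Dual.finrank_ker_add_one_of_ne_zero hl0
    rw [Module.finrank_fin_fun] at h1
    rw [hdim, dim]
    refine Eq.trans ?_ h1
    exact congrArg (fun W : Submodule ℚ (Fin k → ℚ) => Module.finrank ℚ W + 1) hker

end Facet

/-! ### Projected faces as cones over index sets -/

section ConeOf

variable {r k : ℕ}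

/-- The vector `q_i` viewed in `ℚ^k`. -/
def qvec (q : Fin r → Fin k → ℤ) (i : Fin r) : Fin k → ℚ := fun j => (q i j : ℚ)

/-- The cone generated by the `q_i` with `i ∈ J`. -/
def coneOf (q : Fin r → Fin k → ℤ) (J : Set (Fin r)) : PointedCone ℚ (Fin k → ℚ) :=
  PointedCone.hull ℚ (qvec q '' J)

theorem Q_apply (q : Fin r → Fin k → ℤ) (a : Fin r → ℚ) : Q q a = ∑ i, a i • qvec q i := by
  ext j
  simp [Q, Matrix.mulVec, dotProduct, qvec, mul_comm]

theorem Q_single (q : Fin r → Fin k → ℤ) (i : Fin r) : Q q (Pi.single i 1) = qvec q i := by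
  classical
  rw [Q_apply, Finset.sum_eq_single i] <;> simp +contextual

theorem coneOf_fg (q : Fin r → Fin k → ℤ) (J : Set (Fin r)) : (coneOf q J).FG :=
  ⟨(J.toFinite.image (qvec q)).toFinset, by rw [Set.Finite.coe_toFinset]; rfl⟩

theorem coneOf_mono (q : Fin r → Fin k → ℤ) {J J' : Set (Fin r)} (h : J ⊆ J') :
    coneOf q J ≤ coneOf q J' := Submodule.span_mono (Set.image_mono h)

theorem qvec_mem_coneOf (q : Fin r → Fin k → ℤ) {J : Set (Fin r)} {i : Fin r} (hi : i ∈ J) :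
    qvec q i ∈ coneOf q J := Submodule.subset_span (Set.mem_image_of_mem _ hi)

theorem sum_smul_mem {q : Fin r → Fin k → ℤ} {C : PointedCone ℚ (Fin k → ℚ)} {a : Fin r → ℚ}
    (h0 : ∀ i, 0 ≤ a i) (h : ∀ i, 0 < a i → qvec q i ∈ C) : ∑ i, a i • qvec q i ∈ C := by
  refine Submodule.sum_mem _ fun i _ => ?_
  rcases (h0 i).eq_or_lt with hi | hi
  · rw [← hi, zero_smul]; exact zero_mem _
  · exact C.smul_mem hi.le (h i hi)

theorem mem_coneOf {q : Fin r → Fin k → ℤ} {J : Set (Fin r)} {z : Fin k → ℚ} :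
    z ∈ coneOf q J ↔ ∃ a : Fin r → ℚ, (∀ i, 0 ≤ a i) ∧ (∀ i, 0 < a i → i ∈ J) ∧
      ∑ i, a i • qvec q i = z := by
  classical
  constructor
  · intro hz
    induction hz using Submodule.span_induction with
    | mem z hz =>
      obtain ⟨i, hi, rfl⟩ := hz
      refine ⟨Pi.single i 1, fun j => ?_, fun j hj => ?_, by rw [← Q_apply, Q_single]⟩
      · by_cases h : j = i
        · subst h; simp
        · simp [h]
      · by_contra hJ
        have : j ≠ i := by rintro rfl; exact hJ hi
        simp [this] at hj
    | zero => exact ⟨0, fun _ => le_rfl, fun i hi => absurd hi (lt_irrefl _), by simp⟩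
    | add y z _ _ hy hz =>
      obtain ⟨a, ha, haJ, rfl⟩ := hy
      obtain ⟨b, hb, hbJ, rfl⟩ := hz
      refine ⟨a + b, fun i => add_nonneg (ha i) (hb i), fun i hi => ?_, ?_⟩
      · rcases (ha i).eq_or_lt with h | h
        · exact hbJ i (by simpa [← h] using hi)
        · exact haJ i h
      · simp [add_smul, Finset.sum_add_distrib]
    | smul c z _ hz =>
      obtain ⟨a, ha, haJ, rfl⟩ := hz
      obtain ⟨c, hc⟩ := c
      refine ⟨c • a, fun i => mul_nonneg hc (ha i), fun i hi => haJ i ?_, ?_⟩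
      · exact pos_of_mul_pos_right hi hc
      · change _ = c • ∑ i, a i • qvec q i
        simp [Finset.smul_sum, smul_smul]
  · rintro ⟨a, ha, haJ, rfl⟩
    exact sum_smul_mem ha fun i hi => qvec_mem_coneOf q (haJ i hi)

theorem mem_orthant {a : Fin r → ℚ} : a ∈ orthant r ↔ ∀ i, 0 ≤ a i := by
  rw [orthant, PointedCone.mem_positive, Pi.le_def]; rfl

theorem single_mem_orthant (i : Fin r) : (Pi.single i 1 : Fin r → ℚ) ∈ orthant r := by
  classical
  refine mem_orthant.2 fun j => ?_
  by_cases h : j = i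
  · subst h; simp
  · simp [h]

/-- A face of the orthant is generated by the unit vectors it contains. -/
theorem proj_eq_coneOf (q : Fin r → Fin k → ℤ) {γ₀ : PointedCone ℚ (Fin r → ℚ)}
    (h : γ₀.IsFaceOf (orthant r)) :
    proj q γ₀ = coneOf q {i | (Pi.single i 1 : Fin r → ℚ) ∈ γ₀} := by
  classical
  refine le_antisymm ?_ ?_
  · rintro _ ⟨a, ha, rfl⟩
    have ha0 := mem_orthant.1 (h.le ha)
    refine mem_coneOf.2 ⟨a, ha0, fun i hi => ?_, (Q_apply q a).symm⟩
    refine h.mem_of_sum_smul_mem (f := fun i => (Pi.single i 1 : Fin r → ℚ)) (c := a)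
      single_mem_orthant ha0 ?_ i hi
    have hsum : ∑ i, a i • (Pi.single i 1 : Fin r → ℚ) = a := by
      ext j
      simp [Finset.sum_apply, Pi.single_apply]
    rwa [hsum]
  · refine Submodule.span_le.2 ?_
    rintro _ ⟨i, hi, rfl⟩
    exact ⟨_, hi, Q_single q i⟩

theorem exists_face_orthant (J : Set (Fin r)) :
    ∃ γ₀ : PointedCone ℚ (Fin r → ℚ), γ₀.IsFaceOf (orthant r) ∧
      {i | (Pi.single i 1 : Fin r → ℚ) ∈ γ₀} = J := by
  classical
  refine ⟨{ carrier := {a | a ∈ orthant r ∧ ∀ i ∉ J, a i = 0}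
            add_mem' := fun {a b} ha hb => ⟨add_mem ha.1 hb.1, fun i hi => by
              rw [Pi.add_apply, ha.2 i hi, hb.2 i hi, add_zero]⟩
            zero_mem' := ⟨zero_mem _, fun _ _ => rfl⟩
            smul_mem' := fun c a ha => ⟨Submodule.smul_mem _ c ha.1, fun i hi => by
              rw [Pi.smul_apply, ha.2 i hi, smul_zero]⟩ }, ⟨fun a ha => ha.1, ?_⟩, ?_⟩
  · rintro a b c ha hb hc ⟨-, h⟩
    refine ⟨ha, fun i hi => ?_⟩
    have h1 := mem_orthant.1 ha i
    have h2 := mem_orthant.1 hb i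
    have h3 : c * a i + b i = 0 := h i hi
    nlinarith [mul_nonneg hc.le h1]
  · ext i
    constructor
    · rintro ⟨-, h⟩
      by_contra hi
      simpa using h i hi
    · intro hi
      refine ⟨single_mem_orthant i, fun j hj => ?_⟩
      have : j ≠ i := by rintro rfl; exact hj hi
      simp [this]

theorem proj_orthant (q : Fin r → Fin k → ℤ) : proj q (orthant r) = coneOf q Set.univ := by
  rw [proj_eq_coneOf q (PointedCone.IsFaceOf.refl _)]
  congr 1
  exact Set.eq_univ_of_forall single_mem_orthant

theorem mem_projFaces {q : Fin r → Fin k → ℤ} {j : ℕ} {ϑ : PointedCone ℚ (Fin k → ℚ)} :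
    ϑ ∈ projFaces q j ↔ (∃ J, coneOf q J = ϑ) ∧ dim ϑ = j := by
  refine and_congr_left fun _ => ⟨?_, ?_⟩
  · rintro ⟨γ₀, h, rfl⟩
    exact ⟨_, (proj_eq_coneOf q h).symm⟩
  · rintro ⟨J, rfl⟩
    obtain ⟨γ₀, h, rfl⟩ := exists_face_orthant J
    exact ⟨γ₀, h, proj_eq_coneOf q h⟩

/-- A torus orbit consists of all points with one given support, so orbit cones come from supports
of points of `X`. -/
theorem mem_projAFaces {K : Type*} [Field K] {q : Fin r → Fin k → ℤ}
    {𝔞 : Ideal (MvPolynomial (Fin r) K)} {ϑ : PointedCone ℚ (Fin k → ℚ)} :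
    ϑ ∈ projAFaces q 𝔞 ↔ ∃ x ∈ zeroLocus K 𝔞, coneOf q {i | x i ≠ 0} = ϑ := by
  classical
  constructor
  · rintro ⟨γ₀, ⟨h, x, ⟨t, rfl⟩, hx⟩, rfl⟩
    refine ⟨_, hx, ?_⟩
    rw [proj_eq_coneOf q h]
    congr 1
    ext i
    simp [reduction]
  · rintro ⟨x, hx, rfl⟩
    obtain ⟨γ₀, h, hJ⟩ := exists_face_orthant {i | x i ≠ 0}
    refine ⟨γ₀, ⟨h, x, ⟨fun i => if hi : x i ≠ 0 then Units.mk0 (x i) hi else 1, ?_⟩, hx⟩, ?_⟩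
    · ext i
      have : (Pi.single i 1 : Fin r → ℚ) ∈ γ₀ ↔ x i ≠ 0 := by
        change i ∈ {i | (Pi.single i 1 : Fin r → ℚ) ∈ γ₀} ↔ _
        rw [hJ]; rfl
      by_cases hi : x i = 0 <;> simp [reduction, this, hi]
    · rw [proj_eq_coneOf q h, hJ]

theorem face_coneOf {q : Fin r → Fin k → ℤ} {J : Set (Fin r)} {η : PointedCone ℚ (Fin k → ℚ)}
    (h : η.IsFaceOf (coneOf q J)) : η = coneOf q {i | i ∈ J ∧ qvec q i ∈ η} := by
  refine le_antisymm (fun z hz => ?_) ?_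
  · obtain ⟨a, ha, haJ, rfl⟩ := mem_coneOf.1 (h.le hz)
    refine mem_coneOf.2 ⟨a, ha, fun i hi => ⟨haJ i hi, ?_⟩, rfl⟩
    have hsplit := Finset.add_sum_erase Finset.univ (fun i => a i • qvec q i) (Finset.mem_univ i)
    refine h.mem_of_smul_add_mem (qvec_mem_coneOf q (haJ i hi)) (y := ∑ j ∈ Finset.univ.erase i,
      a j • qvec q j) (Submodule.sum_mem _ fun j _ => ?_) hi (by rwa [hsplit])
    rcases (ha j).eq_or_lt with hj | hj
    · rw [← hj, zero_smul]; exact zero_mem _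
    · exact PointedCone.smul_mem _ hj.le (qvec_mem_coneOf q (haJ j hj))
  · refine Submodule.span_le.2 ?_
    rintro _ ⟨i, hi, rfl⟩
    exact hi.2

theorem weight_cast (q : Fin r → Fin k → ℤ) (ν : Fin r →₀ ℕ) :
    (fun j => (Finsupp.weight q ν j : ℚ)) = ∑ i, (ν i : ℚ) • qvec q i := by
  ext j
  rw [Finsupp.weight_apply, Finsupp.sum_fintype _ _ (by simp)]
  simp [qvec, Finset.sum_apply]

theorem exists_clear_denominators {a : Fin r → ℚ} (ha : ∀ i, 0 ≤ a i) :
    ∃ D : ℕ, 0 < D ∧ ∃ β : Fin r →₀ ℕ, ∀ i, (β i : ℚ) = D * a i := by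
  classical
  refine ⟨∏ i, (a i).den, Finset.prod_pos fun i _ => (a i).den_pos, Finsupp.equivFunOnFinite.symm
    (fun i => (∏ j ∈ Finset.univ.erase i, (a j).den) * (a i).num.toNat), fun i => ?_⟩
  have h1 : ((a i).num.toNat : ℚ) = (a i).den * a i := by
    rw [Rat.den_mul_eq_num]
    exact_mod_cast Int.toNat_of_nonneg (Rat.num_nonneg.2 (ha i))
  rw [← Finset.mul_prod_erase Finset.univ _ (Finset.mem_univ i)]
  simp only [Finsupp.equivFunOnFinite_symm_apply_apply, Nat.cast_mul, h1]
  ring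

end ConeOf

/-! ### Faces and extensions of orbit cones -/

section OrbitCones

variable {K : Type*} [Field K] {r k : ℕ}

theorem aeval_monomial_ne_zero_iff {x : Fin r → K} {ν : Fin r →₀ ℕ} :
    aeval x (monomial ν (1 : K)) ≠ 0 ↔ ∀ i, ν i ≠ 0 → x i ≠ 0 := by
  rw [aeval_monomial, map_one, one_mul, Finsupp.prod_fintype _ _ (by simp), Finset.prod_ne_zero_iff]
  simp only [Finset.mem_univ, true_implies]
  refine forall_congr' fun i => ?_
  by_cases h : ν i = 0 <;> simp [h]

theorem IsGradedIdeal.component_mem {q : Fin r → Fin k → ℤ} {𝔞 : Ideal (MvPolynomial (Fin r) K)}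
    (h : IsGradedIdeal q 𝔞) {p : MvPolynomial (Fin r) K} (hp : p ∈ 𝔞) (d : Fin k → ℤ) :
    weightedHomogeneousComponent q d p ∈ 𝔞 :=
  weightedHomogeneousComponent_mem_of_mem K q h hp d

theorem sum_component_eq {M : Type*} [AddCommMonoid M] (w : Fin r → M)
    (p : MvPolynomial (Fin r) K) :
    ∃ S : Finset M, p = ∑ d ∈ S, weightedHomogeneousComponent w d p := by
  refine ⟨(weightedHomogeneousComponent_finsupp (w := w) p).toFinset, ?_⟩
  conv_lhs => rw [← sum_weightedHomogeneousComponent w p]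
  exact finsum_eq_sum _ _

theorem weight_map {M G : Type*} [AddCommMonoid M] [AddCommMonoid G] (w : Fin r → M) (φ : M →+ G)
    (ν : Fin r →₀ ℕ) : Finsupp.weight (fun i => φ (w i)) ν = φ (Finsupp.weight w ν) := by
  simp [Finsupp.weight_apply, Finsupp.sum, map_sum, map_nsmul]

/-- A homogeneous ideal is homogeneous for every coarsening of the grading. -/
theorem IsGradedIdeal.component_map_mem {q : Fin r → Fin k → ℤ}
    {𝔞 : Ideal (MvPolynomial (Fin r) K)} (h : IsGradedIdeal q 𝔞) {G : Type*} [AddCommGroup G]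
    (φ : (Fin k → ℤ) →+ G) {p : MvPolynomial (Fin r) K} (hp : p ∈ 𝔞) (g : G) :
    weightedHomogeneousComponent (fun i => φ (q i)) g p ∈ 𝔞 := by
  classical
  obtain ⟨S, hS⟩ := sum_component_eq q p
  rw [hS, map_sum]
  refine Submodule.sum_mem _ fun d _ => ?_
  have hw := weight_map q φ
  have hd : IsWeightedHomogeneous (fun i => φ (q i)) (weightedHomogeneousComponent q d p) (φ d) :=
    fun {ν} hν => by
      rw [hw, weightedHomogeneousComponent_isWeightedHomogeneous d p hν]
  by_cases hg : φ d = g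
  · rw [← hg, hd.weightedHomogeneousComponent_same]
    exact h.component_mem hp d
  · rw [hd.weightedHomogeneousComponent_ne _ (Ne.symm hg)]
    exact zero_mem _

/-- Faces of orbit cones are orbit cones. -/
theorem face_mem_projAFaces {q : Fin r → Fin k → ℤ} {𝔞 : Ideal (MvPolynomial (Fin r) K)}
    (h : IsGradedIdeal q 𝔞) {ϑ η : PointedCone ℚ (Fin k → ℚ)} (hϑ : ϑ ∈ projAFaces q 𝔞)
    (hη : η.IsFaceOf ϑ) : η ∈ projAFaces q 𝔞 := by
  classical
  obtain ⟨x, hx, rfl⟩ := mem_projAFaces.1 hϑ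
  -- Degree by degree: if `d ∈ η`, each monomial takes the same value at `x` and `y` by the face
  -- property; if `d ∉ η`, each contains a variable that vanishes at `y`.
  set y : Fin r → K := fun i => if qvec q i ∈ η then x i else 0 with hy
  refine mem_projAFaces.2 ⟨y, fun p hp => ?_, ?_⟩
  · obtain ⟨S, hS⟩ := sum_component_eq q p
    rw [hS, map_sum]
    refine Finset.sum_eq_zero fun d _ => ?_
    have hpd := weightedHomogeneousComponent_isWeightedHomogeneous (w := q) d p
    have hp0 := hx _ (h.component_mem hp d)
    set p' := weightedHomogeneousComponent q d p
    rw [aeval_def, eval₂_eq'] at hp0 ⊢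
    by_cases hd : (fun j => (d j : ℚ)) ∈ η
    · rw [← hp0]
      refine Finset.sum_congr rfl fun ν hν => ?_
      congr 1
      have hνd := hpd (mem_support_iff.1 hν)
      rw [← hνd, weight_cast] at hd
      by_cases hsupp : ∀ i, ν i ≠ 0 → x i ≠ 0
      · refine Finset.prod_congr rfl fun i _ => ?_
        by_cases hi : ν i = 0
        · simp [hi]
        · have hqi : qvec q i ∈ η := by
            have hpos : (0 : ℚ) < ν i := by exact_mod_cast Nat.pos_of_ne_zero hi
            have hsplit := Finset.add_sum_erase Finset.univ (fun i => (ν i : ℚ) • qvec q i)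
              (Finset.mem_univ i)
            refine hη.mem_of_smul_add_mem (qvec_mem_coneOf q (hsupp i hi)) (y := ∑ j ∈
              Finset.univ.erase i, (ν j : ℚ) • qvec q j) (Submodule.sum_mem _ fun j _ => ?_) hpos
              (by rwa [hsplit])
            by_cases hj : ν j = 0
            · simp [hj]
            · exact PointedCone.smul_mem _ (Nat.cast_nonneg _) (qvec_mem_coneOf q (hsupp j hj))
          simp [hy, hqi]
      · push Not at hsupp
        obtain ⟨i, hi, hxi⟩ := hsupp
        rw [Finset.prod_eq_zero (Finset.mem_univ i), Finset.prod_eq_zero (Finset.mem_univ i)]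
        · simp [hxi, hi]
        · simp [hy, hxi, hi]
    · refine Finset.sum_eq_zero fun ν hν => ?_
      have hνd := hpd (mem_support_iff.1 hν)
      obtain ⟨i, hi, hqi⟩ : ∃ i, ν i ≠ 0 ∧ qvec q i ∉ η := by
        by_contra! hcon
        refine hd ?_
        rw [← hνd, weight_cast]
        exact sum_smul_mem (fun i => Nat.cast_nonneg _) fun i hi => hcon i (by
          rintro h0; simp [h0] at hi)
      rw [Finset.prod_eq_zero (Finset.mem_univ i), mul_zero]
      simp [hy, hqi, hi]
  · conv_rhs => rw [face_coneOf hη]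
    congr 1
    ext i
    by_cases hqi : qvec q i ∈ η <;> simp [hy, hqi]

open Classical in
/-- If `x` and `y` take the same values on the monomials whose degree is a multiple of
`∑ q_i`, the sum being over the support of `x`, then the orbit cone of `x` is a face of that of
`y`. -/
theorem coneOf_isFaceOf {q : Fin r → Fin k → ℤ} {x y : Fin r → K}
    (hxy : ∀ i, x i ≠ 0 → y i ≠ 0) {δ : Fin k → ℤ}
    (hδ : (fun j => (δ j : ℚ)) = ∑ i ∈ Finset.univ.filter (fun i => x i ≠ 0), qvec q i)
    (h : ∀ ν : Fin r →₀ ℕ, (∃ n : ℕ, Finsupp.weight q ν = n • δ) → (∀ i, ν i ≠ 0 → y i ≠ 0) →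
      ∀ i, ν i ≠ 0 → x i ≠ 0) :
    (coneOf q {i | x i ≠ 0}).IsFaceOf (coneOf q {i | y i ≠ 0}) where
  le := coneOf_mono q hxy
  mem_of_smul_add_mem := by
    classical
    intro p p' a hp hp' ha hsum
    obtain ⟨b, hb, hbJ, rfl⟩ := mem_coneOf.1 hp
    obtain ⟨b', hb', hbJ', rfl⟩ := mem_coneOf.1 hp'
    obtain ⟨c, hc, hcJ, hceq⟩ := mem_coneOf.1 hsum
    obtain ⟨N, hN⟩ := exists_nat_ge (∑ i, c i)
    have hcN : ∀ i, c i ≤ N := fun i =>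
      (Finset.single_le_sum (fun j _ => hc j) (Finset.mem_univ i)).trans hN
    -- The last summand completes `a • p + p' = ∑ c i • q_i` to `N • δ`. Cleared of denominators,
    -- `e` is an exponent supported on `y` to which `h` applies, forcing the support of `b` into
    -- that of `x`.
    set e : Fin r → ℚ := fun i => a * b i + b' i + if x i ≠ 0 then N - c i else 0 with he
    have he1 : ∀ i, 0 ≤ if x i ≠ 0 then N - c i else 0 := fun i => by
      split_ifs
      · exact sub_nonneg.2 (hcN i)
      · exact le_rfl
    have he0 : ∀ i, 0 ≤ e i := fun i =>
      add_nonneg (add_nonneg (mul_nonneg ha.le (hb i)) (hb' i)) (he1 i)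
    have hesum : ∑ i, e i • qvec q i = (N : ℚ) • (fun j => (δ j : ℚ)) := by
      have h1 : ∑ i, (if x i ≠ 0 then N - c i else 0) • qvec q i =
          (N : ℚ) • (fun j => (δ j : ℚ)) - ∑ i, c i • qvec q i := by
        rw [hδ, Finset.smul_sum, Finset.sum_filter, ← Finset.sum_sub_distrib]
        refine Finset.sum_congr rfl fun i _ => ?_
        split_ifs with hi
        · rw [sub_smul]
        · have : c i = 0 := by
            by_contra hne
            exact hi (hcJ i (lt_of_le_of_ne (hc i) (Ne.symm hne)))
          simp [this]
      simp only [he, add_smul, Finset.sum_add_distrib, mul_smul, ← Finset.smul_sum] at h1 ⊢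
      rw [h1, hceq]
      abel
    obtain ⟨D, hD, μ, hμ⟩ := exists_clear_denominators he0
    have hDpos : (0 : ℚ) < D := by exact_mod_cast hD
    have hμe : ∀ i, μ i ≠ 0 ↔ 0 < e i := fun i => by
      rw [← Nat.pos_iff_ne_zero, ← Nat.cast_pos (α := ℚ), hμ]
      exact mul_pos_iff_of_pos_left hDpos
    have key := h μ ⟨D * N, ?_⟩ ?_
    · refine mem_coneOf.2 ⟨b, hb, fun i hi => key i ((hμe i).2 ?_), rfl⟩
      have := he1 i
      have := hb' i
      have := mul_pos ha hi
      simp only [he]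
      linarith
    · have h2 := weight_cast q μ
      simp only [hμ, mul_smul, ← Finset.smul_sum] at h2
      rw [hesum] at h2
      ext j
      have h3 := congrFun h2 j
      simp only [Pi.smul_apply, smul_eq_mul] at h3
      have h4 : ((Finsupp.weight q μ j : ℤ) : ℚ) = (((D * N) • δ) j : ℤ) := by
        rw [h3]; simp; ring
      exact_mod_cast h4
    · intro i hi
      have hi := (hμe i).1 hi
      by_contra hyi
      have hyi : y i = 0 := by simpa using hyi
      have hxi : x i = 0 := by
        by_contra hne
        exact hxy i hne hyi
      have hbi : b i = 0 := by
        by_contra hne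
        exact hbJ i (lt_of_le_of_ne (hb i) (Ne.symm hne)) hyi
      have hbi' : b' i = 0 := by
        by_contra hne
        exact hbJ' i (lt_of_le_of_ne (hb' i) (Ne.symm hne)) hyi
      simp [he, hxi, hbi, hbi'] at hi

/-- Every orbit cone is a face of an orbit cone that extends it in the direction of a given point
of `Q(γ)`. -/
theorem exists_orbitCone_isFaceOf [IsAlgClosed K] {q : Fin r → Fin k → ℤ}
    {𝔞 : Ideal (MvPolynomial (Fin r) K)} (h_hom : IsGradedIdeal q 𝔞) (h_mon : MonomialFree 𝔞)
    (h_irr : 𝔞.radical.IsPrime) {ω : PointedCone ℚ (Fin k → ℚ)} (hω : ω ∈ projAFaces q 𝔞)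
    {v : Fin k → ℚ} (hv : v ∈ proj q (orthant r)) :
    ∃ ϑ ∈ projAFaces q 𝔞, ω.IsFaceOf ϑ ∧ ∃ z ∈ ω, v + z ∈ ϑ := by
  classical
  obtain ⟨x, hx, rfl⟩ := mem_projAFaces.1 hω
  rw [proj_orthant] at hv
  obtain ⟨a, ha, -, rfl⟩ := mem_coneOf.1 hv
  obtain ⟨D, hD, β, hβ⟩ := exists_clear_denominators ha
  let φ : Fin r →₀ ℕ := Finsupp.equivFunOnFinite.symm (fun i => if x i ≠ 0 then 1 else 0)
  have hφ : ∀ i, φ i = if x i ≠ 0 then 1 else 0 := fun i => rfl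
  set δ := Finsupp.weight q φ with hδ
  have hδQ : (fun j => (δ j : ℚ)) = ∑ i ∈ Finset.univ.filter (fun i => x i ≠ 0), qvec q i := by
    rw [hδ, weight_cast, Finset.sum_filter]
    refine Finset.sum_congr rfl fun i _ => ?_
    rw [hφ]
    split_ifs <;> simp
  -- Modulo `δ`, monomials of degree in `ℤδ` become invariants, so `x` and `y` will agree on them.
  let π : (Fin k → ℤ) →+ (Fin k → ℤ) ⧸ AddSubgroup.zmultiples δ := QuotientAddGroup.mk' _
  have hπ := weight_map q π
  have hπδ : π δ = 0 :=
    (QuotientAddGroup.eq_zero_iff _).2 (AddSubgroup.mem_zmultiples δ)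
  have hβ' : monomial β (1 : K) ∉ 𝔞.radical := by
    rintro ⟨n, hn⟩
    rw [monomial_pow, one_pow] at hn
    exact h_mon _ hn
  obtain ⟨y, hy, hinv, n, hn, ν, hν, hyν⟩ := exists_point_monomial_ne_zero (fun i => π (q i))
    (fun p hp g => h_hom.component_map_mem π hp g) h_irr hx hβ'
  have hmono : ∀ μ : Fin r →₀ ℕ, (∃ n : ℕ, Finsupp.weight q μ = n • δ) →
      aeval y (monomial μ (1 : K)) = aeval x (monomial μ (1 : K)) := by
    rintro μ ⟨n, hμ⟩
    refine hinv _ (isWeightedHomogeneous_monomial _ _ _ ?_)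
    rw [hπ, hμ, map_nsmul, hπδ, nsmul_zero]
  have hxy : ∀ i, x i ≠ 0 → y i ≠ 0 := by
    have h1 : aeval x (monomial φ (1 : K)) ≠ 0 :=
      aeval_monomial_ne_zero_iff.2 fun i hi hxi => hi (by rw [hφ]; simp [hxi])
    rw [← hmono φ ⟨1, by rw [one_nsmul]⟩, aeval_monomial_ne_zero_iff] at h1
    intro i hi
    exact h1 i (by rw [hφ]; simp [hi])
  refine ⟨_, mem_projAFaces.2 ⟨y, hy, rfl⟩, coneOf_isFaceOf hxy hδQ fun μ hμ hyμ => ?_, ?_⟩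
  · rw [← aeval_monomial_ne_zero_iff] at hyμ ⊢
    rwa [← hmono μ hμ]
  · obtain ⟨m, hm⟩ : ∃ m : ℤ, m • δ = Finsupp.weight q ν - n • Finsupp.weight q β := by
      rw [← AddSubgroup.mem_zmultiples_iff, ← QuotientAddGroup.eq_zero_iff]
      change π _ = 0
      rw [map_sub, map_nsmul, ← hπ, ← hπ, hν, sub_self]
    have hδx : (fun j => (δ j : ℚ)) ∈ coneOf q {i | x i ≠ 0} := by
      rw [hδQ]
      exact Submodule.sum_mem _ fun i hi => qvec_mem_coneOf q (Finset.mem_filter.1 hi).2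
    have hνy : ∑ i, (ν i : ℚ) • qvec q i ∈ coneOf q {i | y i ≠ 0} :=
      sum_smul_mem (fun i => Nat.cast_nonneg _) fun i hi => qvec_mem_coneOf q
        (aeval_monomial_ne_zero_iff.1 hyν i (by rintro h0; simp [h0] at hi))
    set δQ : Fin k → ℚ := fun j => (δ j : ℚ) with hδQ'
    have hrel : ∑ i, (ν i : ℚ) • qvec q i =
        ((n : ℚ) * D) • ∑ i, a i • qvec q i + (m : ℚ) • δQ := by
      have h2 : ∑ i, (β i : ℚ) • qvec q i = (D : ℚ) • ∑ i, a i • qvec q i := by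
        simp only [hβ, mul_smul, Finset.smul_sum]
      rw [mul_smul, ← h2, ← weight_cast, ← weight_cast]
      ext j
      have h3 := congrFun hm j
      simp only [Pi.smul_apply, Pi.sub_apply, smul_eq_mul, nsmul_eq_mul] at h3
      simp only [Pi.add_apply, Pi.smul_apply, smul_eq_mul, hδQ']
      have h4 : ((m * δ j : ℤ) : ℚ) = ((Finsupp.weight q ν j - n * Finsupp.weight q β j : ℤ) : ℚ) :=
        by exact_mod_cast h3
      push_cast at h4
      linarith
    have hnD : (0 : ℚ) < n * D := by positivity
    -- The integer `m` may be negative; adding `|m| • δ` makes the correction `z` a nonnegative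
    -- multiple of `δ`, hence a point of `ω`.
    have hmm : (0 : ℚ) ≤ m + |(m : ℚ)| := by linarith [neg_abs_le (m : ℚ)]
    refine ⟨((n * D : ℚ)⁻¹ * (m + |(m : ℚ)|)) • δQ,
      PointedCone.smul_mem _ (by positivity) hδx, ?_⟩
    have : ∑ i, a i • qvec q i + ((n * D : ℚ)⁻¹ * (m + |(m : ℚ)|)) • δQ =
        (n * D : ℚ)⁻¹ • (∑ i, (ν i : ℚ) • qvec q i + |(m : ℚ)| • δQ) := by
      rw [hrel, mul_smul _ (_ + _), add_assoc, ← add_smul, smul_add, inv_smul_smul₀ hnD.ne']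
    rw [this]
    exact PointedCone.smul_mem _ (by positivity)
      (add_mem hνy (PointedCone.smul_mem _ (abs_nonneg _) (coneOf_mono q hxy hδx)))

end OrbitCones

/-! ### Convexity arguments for chambers -/

section Chambers

variable {k : ℕ} {Ω : Set (PointedCone ℚ (Fin k → ℚ))} {Γ : Set (Fin k → ℚ)}

/-- If `w` is interior to `Γ`, a point lying in all full-dimensional cones of `Ω` through `w` lies
in all cones of `Ω` through `w`. -/
theorem mem_of_forall_full_dim (hfin : Ω.Finite) (hfg : ∀ ϑ ∈ Ω, ϑ.FG)
    (hface : ∀ ϑ ∈ Ω, ∀ η, η.IsFaceOf ϑ → η ∈ Ω)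
    (hext : ∀ ω ∈ Ω, ∀ v ∈ Γ, ∃ ϑ ∈ Ω, ω.IsFaceOf ϑ ∧ ∃ z ∈ ω, v + z ∈ ϑ)
    {u w : Fin k → ℚ} (hw : ∀ v, ∃ ε : ℚ, 0 < ε ∧ w + ε • v ∈ Γ)
    (hu : ∀ ϑ ∈ Ω, dim ϑ = k → w ∈ ϑ → u ∈ ϑ) :
    ∀ ϑ ∈ Ω, w ∈ ϑ → u ∈ ϑ := by
  intro ϑ hϑ hwϑ
  set ω := minFace ϑ w with hω
  have hωϑ : ω.IsFaceOf ϑ := minFace_isFaceOf ϑ w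
  have hwω : w ∈ ω := self_mem_minFace hwϑ
  obtain ⟨ϑ', ⟨hϑ', hωϑ'⟩, htop, hmem⟩ := exists_mem_of_forall_exists_mem
    (S := {ϑ' | ϑ' ∈ Ω ∧ ω.IsFaceOf ϑ'}) (hfin.subset fun _ h => h.1)
    (fun ϑ' => ϑ' ⊔ PointedCone.hull ℚ {-w}) (fun ϑ' h => (hfg ϑ' h.1).sup
      (Submodule.fg_span_singleton _))
    (fun ϑ' => Submodule.span ℚ (ϑ' : Set (Fin k → ℚ)))
    (by
      rintro ϑ' ⟨hϑ', hωϑ'⟩ z hz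
      obtain ⟨p, hp, _, hn, rfl⟩ := Submodule.mem_sup.1 hz
      obtain ⟨t, rfl⟩ := Submodule.mem_span_singleton.1 hn
      refine Submodule.add_mem _ (Submodule.subset_span hp) ?_
      exact Submodule.smul_mem _ (t : ℚ) (Submodule.neg_mem _
        (Submodule.subset_span (hωϑ'.le hwω))))
    (by
      intro v
      obtain ⟨ε, hε, hεv⟩ := hw v
      obtain ⟨ϑ', hϑ', hωϑ', z, hz, hzϑ'⟩ := hext ω (hface ϑ hϑ ω hωϑ) _ hεv
      obtain ⟨-, c, hc, hcz⟩ := mem_minFace.1 hz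
      have hcz' : c • w - z ∈ ω :=
        ⟨hcz, c, hc, by rw [sub_sub_cancel]; exact hωϑ.le hz⟩
      refine ⟨ϑ', ⟨hϑ', hωϑ'⟩, Submodule.mem_sup.2 ⟨ε⁻¹ • ((w + ε • v + z) + (c • w - z)),
        ϑ'.smul_mem (by positivity) (add_mem hzϑ' (hωϑ'.le hcz')),
        (ε⁻¹ * (1 + c)) • (-w), PointedCone.smul_mem _ (by positivity)
          (Submodule.subset_span rfl), ?_⟩⟩
      ext j
      simp only [Pi.add_apply, Pi.smul_apply, Pi.sub_apply, Pi.neg_apply, smul_eq_mul]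
      field_simp
      ring)
    (w - u)
  have hdim : dim ϑ' = k := by
    rw [dim, htop, finrank_top, Module.finrank_fin_fun]
  have huϑ' := hu ϑ' hϑ' hdim (hωϑ'.le hwω)
  obtain ⟨p, hp, _, hn, hpn⟩ := Submodule.mem_sup.1 hmem
  obtain ⟨t, rfl⟩ := Submodule.mem_span_singleton.1 hn
  have hsum : u + p ∈ ω := by
    have : u + p = (1 + (t : ℚ)) • w := by
      have h1 : t • (-w) = (t : ℚ) • (-w) := rfl
      rw [h1, smul_neg, ← sub_eq_add_neg, sub_eq_iff_eq_add] at hpn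
      rw [hpn, add_smul, one_smul]
      abel
    rw [this]
    exact ω.smul_mem (add_nonneg zero_le_one t.2) hwω
  exact hωϑ.le (hωϑ'.mem_of_add_mem_left huϑ' hp hsum)

/-- If all cones of `Ω` through `w` contain `u`, then each cone of `Ω` meeting the segment from
`w` to `u` outside of `u` contains `w`. -/
theorem mem_of_segment_mem (hfin : Ω.Finite) (hfg : ∀ ϑ ∈ Ω, ϑ.FG)
    (hface : ∀ ϑ ∈ Ω, ∀ η, η.IsFaceOf ϑ → η ∈ Ω)
    (hext : ∀ ω ∈ Ω, ∀ v ∈ Γ, ∃ ϑ ∈ Ω, ω.IsFaceOf ϑ ∧ ∃ z ∈ ω, v + z ∈ ϑ)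
    {u w : Fin k → ℚ} (hw : w ∈ Γ) (hu : ∀ ϑ ∈ Ω, w ∈ ϑ → u ∈ ϑ)
    {η : PointedCone ℚ (Fin k → ℚ)} (hη : η ∈ Ω) {s : ℚ} (hs0 : 0 ≤ s) (hs1 : s < 1)
    (hs : (1 - s) • w + s • u ∈ η) : w ∈ η := by
  by_contra hwη
  set B : Set (PointedCone ℚ (Fin k → ℚ)) :=
    {η | η ∈ Ω ∧ w ∉ η ∧ ∃ s : ℚ, 0 ≤ s ∧ s < 1 ∧ (1 - s) • w + s • u ∈ η} with hB
  have hhit : ∀ η ∈ B, ∃ σ : ℚ, 0 < σ ∧ σ < 1 ∧ (1 - σ) • w + σ • u ∈ η ∧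
      ∀ σ' : ℚ, (1 - σ') • w + σ' • u ∈ η → σ ≤ σ' := by
    rintro η ⟨hη, hwη, s, hs0, hs1, hs⟩
    have hs0' : 0 < s := by
      refine lt_of_le_of_ne hs0 ?_
      rintro rfl
      exact hwη (by simpa using hs)
    obtain ⟨H, hH⟩ := exists_describes_of_fg (hfg η hη)
    obtain ⟨-, -, τ, hτ0, hτ1, -, -, hmem, hmin⟩ := hH.exists_first_hit hwη hs
    have hcomb : ∀ τ : ℚ, (1 - τ) • w + τ • ((1 - s) • w + s • u) =
        (1 - τ * s) • w + (τ * s) • u := fun τ => by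
      ext j
      simp only [Pi.add_apply, Pi.smul_apply, smul_eq_mul]
      ring
    refine ⟨τ * s, mul_pos hτ0 hs0', ?_, by rwa [← hcomb], fun σ' hσ' => ?_⟩
    · nlinarith
    · rw [← le_div_iff₀ hs0']
      refine hmin _ ?_
      rwa [hcomb, div_mul_cancel₀ _ hs0'.ne']
  choose! σ hσ0 hσ1 hσ hσmin using hhit
  -- Take a cone met closest to `w`, at `p`, and extend the minimal face of `p` towards `w`. If the
  -- extension contains `w`, it contains `u`, and the face property at `p` puts `w` in `η`;
  -- otherwise it meets the segment before `p`.
  obtain ⟨η, hηB, hmin⟩ := Set.exists_min_image B σ (hfin.subset fun _ h => h.1)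
    ⟨η, hη, hwη, s, hs0, hs1, hs⟩
  have h0 := hσ0 η hηB
  have h1 := hσ1 η hηB
  set p := (1 - σ η) • w + σ η • u with hp
  have hpω : p ∈ minFace η p := self_mem_minFace (hσ η hηB)
  have hωη := minFace_isFaceOf η p
  obtain ⟨ϑ, hϑ, hωϑ, z, hz, hzϑ⟩ := hext _ (hface η hηB.1 _ hωη) w hw
  by_cases hwϑ : w ∈ ϑ
  · refine hηB.2.1 (hωη.le (hωϑ.mem_of_smul_add_mem hwϑ (ϑ.smul_mem h0.le (hu ϑ hϑ hwϑ))
      (sub_pos.2 h1) hpω))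
  · obtain ⟨-, c, hc, hcz⟩ := mem_minFace.1 hz
    have hcz' : c • p - z ∈ minFace η p :=
      ⟨hcz, c, hc, by rw [sub_sub_cancel]; exact hωη.le hz⟩
    have hc1 : 0 < 1 + c := by linarith
    have hmem : (1 - c * σ η / (1 + c)) • w + (c * σ η / (1 + c)) • u ∈ ϑ := by
      have : (1 - c * σ η / (1 + c)) • w + (c * σ η / (1 + c)) • u =
          (1 + c)⁻¹ • ((w + z) + (c • p - z)) := by
        rw [hp]
        ext j
        simp only [Pi.add_apply, Pi.smul_apply, Pi.sub_apply, smul_eq_mul]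
        field_simp
        ring
      rw [this]
      exact ϑ.smul_mem (by positivity) (add_mem hzϑ (hωϑ.le hcz'))
    have hlt : c * σ η / (1 + c) < σ η := by
      rw [div_lt_iff₀ hc1]
      linarith
    have hϑB : ϑ ∈ B := ⟨hϑ, hwϑ, _, by positivity, hlt.trans h1, hmem⟩
    exact absurd ((hmin ϑ hϑB).trans (hσmin ϑ hϑB _ hmem)) (not_le.2 hlt)

end Chambers

/-! ### Interior points, the algorithm and the main theorem -/

/-- A point of the intrinsic interior of a full-dimensional cone can be moved a bit in every
direction. -/
theorem exists_pos_add_smul_mem {k : ℕ} {C : PointedCone ℚ (Fin k → ℚ)} (hdim : dim C = k)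
    {w : Fin k → ℚ} (hw : w ∈ intrinsicInterior ℚ (C : Set (Fin k → ℚ))) (v : Fin k → ℚ) :
    ∃ ε : ℚ, 0 < ε ∧ w + ε • v ∈ C := by
  have htop : Submodule.span ℚ (C : Set (Fin k → ℚ)) = ⊤ :=
    Submodule.eq_top_of_finrank_eq (by rw [Module.finrank_fin_fun]; exact hdim)
  obtain ⟨y, hy, rfl⟩ := mem_intrinsicInterior.1 hw
  have hdir : (affineSpan ℚ (C : Set (Fin k → ℚ))).direction = ⊤ := by
    rw [eq_top_iff, ← htop, Submodule.span_le]
    intro z hz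
    have := AffineSubspace.vsub_mem_direction (mem_affineSpan ℚ hz)
      (mem_affineSpan ℚ (C.zero_mem : (0 : Fin k → ℚ) ∈ (C : Set (Fin k → ℚ))))
    simpa using this
  have hmem : ∀ t : ℚ, (y : Fin k → ℚ) + t • v ∈ affineSpan ℚ (C : Set (Fin k → ℚ)) := fun t => by
    rw [add_comm]
    exact AffineSubspace.vadd_mem_of_mem_direction (by rw [hdir]; trivial) y.2
  let φ : ℚ → affineSpan ℚ (C : Set (Fin k → ℚ)) := fun t => ⟨y + t • v, hmem t⟩
  have hφ : Continuous φ := by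
    refine Continuous.subtype_mk ?_ _
    fun_prop
  have hφ0 : φ 0 = y := Subtype.ext (by simp [φ])
  have hev : φ ⁻¹' ((↑) ⁻¹' (C : Set (Fin k → ℚ))) ∈ 𝓝 (0 : ℚ) :=
    hφ.continuousAt.preimage_mem_nhds (by rw [hφ0]; exact mem_interior_iff_mem_nhds.1 hy)
  obtain ⟨ε, h, hε⟩ := (Filter.inter_mem (nhdsWithin_le_nhds hev)
    (self_mem_nhdsWithin (s := Set.Ioi (0 : ℚ)))) |> Filter.nonempty_of_mem
  exact ⟨ε, hε, h⟩

theorem mem_interAt {k : ℕ} {S : Set (PointedCone ℚ (Fin k → ℚ))} {u w : Fin k → ℚ} :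
    u ∈ interAt S w ↔ ∀ ϑ ∈ S, w ∈ ϑ → u ∈ ϑ := by
  simp [interAt, Submodule.mem_sInf]

open Classical in
/-- The algorithm computes the intersection of the cones passing the facet test. -/
theorem mem_chamberAlgorithm {k : ℕ} {A : Set (PointedCone ℚ (Fin k → ℚ))}
    {L : List (PointedCone ℚ (Fin k → ℚ))} {u : Fin k → ℚ} :
    u ∈ chamberAlgorithm A L ↔ ∀ ϑ ∈ L, (∀ η, IsFacet η ϑ → η ∈ A) → u ∈ ϑ := by
  -- The starting cone is left free for the induction over the fold.
  have key : ∀ (L : List (PointedCone ℚ (Fin k → ℚ))) (C : PointedCone ℚ (Fin k → ℚ)),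
      u ∈ L.foldl (fun l ϑ => if ¬ l ≤ ϑ ∧ (∀ η, IsFacet η ϑ → η ∈ A) then l ⊓ ϑ else l) C ↔
        u ∈ C ∧ ∀ ϑ ∈ L, (∀ η, IsFacet η ϑ → η ∈ A) → u ∈ ϑ := by
    intro L
    induction L with
    | nil => simp
    | cons ϑ L ih =>
      intro C
      rw [List.foldl_cons, ih, List.forall_mem_cons, ← and_assoc]
      refine and_congr_left fun _ => ?_
      split_ifs with h
      · rw [Submodule.mem_inf]
        exact ⟨fun hu => ⟨hu.1, fun _ => hu.2⟩, fun hu => ⟨hu.1, hu.2 h.2⟩⟩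
      · refine ⟨fun hu => ⟨hu, fun hA => ?_⟩, fun hu => hu.1⟩
        by_contra hne
        exact h ⟨fun hle => hne (hle hu), hA⟩
  rw [chamberAlgorithm, key]
  simp

theorem finite_coneOf {r k : ℕ} (q : Fin r → Fin k → ℤ) :
    {ϑ | ∃ J, coneOf q J = ϑ}.Finite := Set.finite_range _

end GITFan

end

theorem mainTheorem1 {K : Type*} [Field K] [IsAlgClosed K] [CharZero K] {r k : ℕ}
    (q : Fin r → Fin k → ℤ) (𝔞 : Ideal (MvPolynomial (Fin r) K))
    (h_hom : GITFan.IsGradedIdeal q 𝔞)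
    (h_mon : GITFan.MonomialFree 𝔞)
    (h_irr : 𝔞.radical.IsPrime)
    (h_dim : GITFan.dim (GITFan.proj q (GITFan.orthant r)) = k)
    (w : Fin k → ℚ)
    (hw : w ∈ intrinsicInterior ℚ (GITFan.proj q (GITFan.orthant r) : Set (Fin k → ℚ))) :
    {ϑ | ϑ ∈ GITFan.projFaces q k ∧ w ∈ ϑ}.Finite ∧
    (∀ L : List (PointedCone ℚ (Fin k → ℚ)),
      (∀ ϑ, ϑ ∈ L ↔ ϑ ∈ GITFan.projFaces q k ∧ w ∈ ϑ) →
      GITFan.chamberAlgorithm (GITFan.projAFacesDim q 𝔞 (k - 1)) L = GITFan.chamber q 𝔞 w) ∧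
    GITFan.interAt (GITFan.projFacesZero q 𝔞) w = GITFan.chamber q 𝔞 w ∧
    GITFan.interAt (GITFan.projFacesZero q 𝔞) w =
      GITFan.interAt (GITFan.projAFacesDim q 𝔞 k) w := by
  open GITFan in
  have hsub : ∀ ϑ ∈ projAFaces q 𝔞, ∃ J, coneOf q J = ϑ := fun ϑ hϑ => by
    obtain ⟨x, -, h⟩ := mem_projAFaces.1 hϑ
    exact ⟨_, h⟩
  have hfg : ∀ ϑ ∈ projAFaces q 𝔞, ϑ.FG := fun ϑ hϑ => by
    obtain ⟨J, rfl⟩ := hsub ϑ hϑ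
    exact coneOf_fg q J
  have hfin : (projAFaces q 𝔞).Finite := (finite_coneOf q).subset hsub
  have hface : ∀ ϑ ∈ projAFaces q 𝔞, ∀ η, η.IsFaceOf ϑ → η ∈ projAFaces q 𝔞 :=
    fun ϑ hϑ η hη => face_mem_projAFaces h_hom hϑ hη
  have hext : ∀ ω ∈ projAFaces q 𝔞, ∀ v ∈ (proj q (orthant r) : Set (Fin k → ℚ)),
      ∃ ϑ ∈ projAFaces q 𝔞, ω.IsFaceOf ϑ ∧ ∃ z ∈ ω, v + z ∈ ϑ := fun ω hω v hv =>
    exists_orbitCone_isFaceOf h_hom h_mon h_irr hω hv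
  have hwΓ : w ∈ (proj q (orthant r) : Set (Fin k → ℚ)) := intrinsicInterior_subset hw
  have hchamber : interAt (projAFacesDim q 𝔞 k) w = chamber q 𝔞 w := by
    ext u
    rw [chamber, mem_interAt, mem_interAt]
    refine ⟨fun hu => ?_, fun hu ϑ hϑ => hu ϑ hϑ.1⟩
    exact mem_of_forall_full_dim hfin hfg hface hext (exists_pos_add_smul_mem h_dim hw)
      fun ϑ hϑ hd => hu ϑ ⟨hϑ, hd⟩
  have hzero : interAt (projFacesZero q 𝔞) w = chamber q 𝔞 w := by
    refine le_antisymm ?_ ?_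
    · rw [← hchamber]
      intro u hu
      rw [mem_interAt] at hu ⊢
      rintro ϑ ⟨hϑ, hd⟩
      refine hu ϑ ⟨mem_projFaces.2 ⟨hsub ϑ hϑ, hd⟩, fun η hη => ⟨hface ϑ hϑ η hη.1, ?_⟩⟩
      have := hη.2
      omega
    · intro u hu
      rw [chamber, mem_interAt] at hu
      rw [mem_interAt]
      rintro ϑ ⟨hϑ, hfacet⟩ hwϑ
      obtain ⟨⟨J, rfl⟩, hd⟩ := mem_projFaces.1 hϑ
      by_contra huϑ
      obtain ⟨η, hη, t, ht0, ht1, hmem⟩ := exists_isFacet_mem (coneOf_fg q J) hd huϑ hwϑ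
      have hηΩ := (hfacet η hη).1
      -- Seen from `w` the parameter is `1 - t`, and `t > 0` says that the entry point is not `u`.
      have hwη : w ∈ η := mem_of_segment_mem hfin hfg hface hext hwΓ hu hηΩ (s := 1 - t)
        (by linarith) (by linarith) (by rwa [sub_sub_cancel, add_comm])
      exact huϑ (hη.1.le (hu η hηΩ hwη))
  refine ⟨?_, fun L hL => ?_, hzero, hzero.trans hchamber.symm⟩
  · exact (finite_coneOf q).subset fun ϑ hϑ => (mem_projFaces.1 hϑ.1).1
  · rw [← hzero]
    ext u
    rw [mem_chamberAlgorithm, mem_interAt]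
    constructor
    · rintro h ϑ ⟨hϑ, hA⟩ hwϑ
      exact h ϑ ((hL ϑ).2 ⟨hϑ, hwϑ⟩) hA
    · intro h ϑ hϑ hA
      exact h ϑ ⟨((hL ϑ).1 hϑ).1, hA⟩ ((hL ϑ).1 hϑ).2
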